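/- **Theorem.** Equip $\bigotimes^d\mathbb R^n$ with the inner product determined by $\langle y_1\otimes\cdots\otimes y_d,\,x_1\otimes\cdots\otimes x_d\rangle=\prod_i\langle y_i,x_i\rangle$ and the associated (Hilbert–Schmidt) norm, and for a tensor $\mathbf z$ let $L_{\mathbf z}(y_1,\dots,y_d)=\langle \mathbf z,\,y_1\otimes\cdots\otimes y_d\rangle$. Write $L(v^j,w^{d-j})$ for the value of $L$ at $j$ copies of $v$ followed by $d-j$ copies of $w$, and $u_1\vee\cdots\vee u_d=\frac1{d!}\sum_{\eta\in S_d}u_{\eta(1)}\otimes\cdots\otimes u_{\eta(d)}$; let $(\vee^{j}v)\vee(\vee^{d-j}w)$ denote this product for $j$ copies of $v$ and $d-j$ copies of $w$. Let $\mathbf z\in\bigotimes^d\mathbb R^n$ be a symmetric tensor, let $x_1\otimes\cdots\otimes x_d$ be a best rank-$1$ approximation of $\mathbf z$ (a minimizer of the Hilbert–Schmidt distance to $\mathbf z$ among tensors of rank at most $1$), and assume that $x_1\otimes\cdots\otimes x_d$ is not symmetric. Let $\mathcal H=\operatorname{span}\{x_1,\dots,x_d\}$ and $\lambda=\|x_1\|\cdots\|x_d\|$.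 Consider the following procedure, which uses only $x_1,\dots,x_d$. "Rotating $x$ towards $y$ by $t$" means rotating $x$ in the plane $\operatorname{span}\{x,y\}$ by the angle $t$ in the direction of $y$ (by $|t|$ in the opposite direction if $t<0$). * *Step I.* Replace each $x_i$ by $x_i/\|x_i\|$ and reorder the vectors so that $x_1,x_2$ are linearly independent. * *Step II* (if $d\ge3$). Start with $y=x_d$. For $l=1,\dots,d-3$, let $u=x_{d-l}$. If $u,y$ are linearly independent and $\theta$ is the angle between them, replace $y$ by the vector obtained by rotating $u$ towards $y$ by $\frac{l\theta}{l+1}$. If $u=y$, keep $y$. If $u=-y$, keep $y$ and replace $x_1$ by $-x_1$. * *Step III.* Let $f_1=\frac{x_1+x_2}{\|x_1+x_2\|}$ and $f_2=\frac{x_1-x_2}{\|x_1-x_2\|}$. If $d=2$, let $v=f_1$, $w=f_2$, $\varepsilon=1$. If $d\ge3$ and $f_1,y$ are linearly dependent, let $v=f_2$, $w=y$, $\varepsilon=-1$. If $d\ge3$ and $f_1,y$ are linearly independent with angle $\theta$, put $\alpha=\frac{\theta-\pi/2}{d}$, let $v$ be $f_1$ rotated towards $y$ by $(d-2)\alpha$,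 let $w$ be $y$ rotated towards $f_1$ by $2\alpha$, and let $\varepsilon=1$. Then a reordering as in Step I exists, and for every such reordering: 1. $v,w\in\mathcal H$ are orthonormal, $\varepsilon\in\{1,-1\}$, $L_{\mathbf z}(v^2,w^{d-2})=\varepsilon\lambda$ (so the value is $\pm1$ if the given $x_i$ are unit vectors), and $\varepsilon\lambda\; v\otimes v\otimes w\otimes\cdots\otimes w$ is a best rank-$1$ approximation of $\mathbf z$. 2. On $\mathcal H$, the form $L_{\mathbf z}$ coincides with the multilinear form of the tensor $$\mathbf r=-\varepsilon\lambda\sum_{l=0}^{\lfloor d/2\rfloor}\binom{d}{2l}(-1)^l\,(\vee^{2l}v)\vee(\vee^{d-2l}w),$$ that is, $L_{\mathbf z}(y_1,\dots,y_d)=L_{\mathbf r}(y_1,\dots,y_d)$ for all $y_1,\dots,y_d\in\mathcal H$. 3. If $n=2$, then $\mathbf z=\mathbf r$. Consequently, if $\mathbf z'$ is another symmetric tensor which has $x_1\otimes\cdots\otimes x_d$ as a best rank-$1$ approximation, then $L_{\mathbf z}=L_{\mathbf z'}$ on $\mathcal H$, and $\mathbf z=\mathbf z'$ if $n=2$. 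-/

import Mathlib

open scoped TensorProduct

noncomputable section

namespace SymTensor

/-- The Euclidean space `ℝⁿ`. -/
abbrev Vec (n : ℕ) : Type := EuclideanSpace ℝ (Fin n)

/-- The tensor product `⨂^d ℝⁿ`. -/
abbrev Tens (d n : ℕ) : Type := ⨂[ℝ] _ : Fin d, Vec n

/-- The elementary tensor `x₁ ⊗ ⋯ ⊗ x_d`. -/
def elem {d n : ℕ} (x : Fin d → Vec n) : Tens d n := PiTensorProduct.tprod ℝ x

/-- The permutation of the factors of a tensor. -/
def permute {d n : ℕ} (η : Equiv.Perm (Fin d)) : Tens d n ≃ₗ[ℝ] Tens d n :=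
  PiTensorProduct.reindex ℝ (fun _ : Fin d => Vec n) η

/-- A tensor is symmetric if it is fixed by all permutations of its factors. -/
def IsSymm {d n : ℕ} (z : Tens d n) : Prop := ∀ η : Equiv.Perm (Fin d), permute η z = z

/-- The inner product of tensors as a bilinear form, determined by
`⟨y₁ ⊗ ⋯ ⊗ y_d, x₁ ⊗ ⋯ ⊗ x_d⟩ = ∏ ⟨y_i, x_i⟩` (see `hsInner_elem`). -/
def hsInner {d n : ℕ} : Tens d n →ₗ[ℝ] Tens d n →ₗ[ℝ] ℝ :=
  PiTensorProduct.dualDistrib ∘ₗ PiTensorProduct.map (fun _ : Fin d => innerₗ (Vec n))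

theorem hsInner_elem {d n : ℕ} (y x : Fin d → Vec n) :
    hsInner (elem y) (elem x) = ∏ i, inner ℝ (y i) (x i) := by
  simp [hsInner, elem]

/-- The Hilbert–Schmidt norm. -/
def HS {d n : ℕ} (z : Tens d n) : ℝ := Real.sqrt (hsInner z z)

/-- The multilinear form `L_z` of a tensor: if `z = ∑ z₁ⁱ ⊗ ⋯ ⊗ z_dⁱ`, then
`L_z (y₁, …, y_d) = ∑ ⟨y₁, z₁ⁱ⟩ ⋯ ⟨y_d, z_dⁱ⟩` (see `L_sum_elem`). -/
def L {d n : ℕ} (z : Tens d n) : MultilinearMap ℝ (fun _ : Fin d => Vec n) ℝ :=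
  (hsInner z).compMultilinearMap (PiTensorProduct.tprod ℝ)

theorem L_sum_elem {d n r : ℕ} (z : Fin r → Fin d → Vec n) (y : Fin d → Vec n) :
    L (∑ i, elem (z i)) y = ∑ i, ∏ k, inner ℝ (y k) (z i k) := by
  have h : ∀ t : Tens d n, L t y = hsInner t (elem y) := fun _ => rfl
  rw [h, map_sum, LinearMap.sum_apply]
  refine Finset.sum_congr rfl fun i _ => ?_
  rw [hsInner_elem]
  exact Finset.prod_congr rfl fun k _ => real_inner_comm _ _

/-- The tensor rank: the least number of elementary tensors with sum `z`. -/
def tensorRank {d n : ℕ} (z : Tens d n) : ℕ :=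
  sInf {r : ℕ | ∃ x : Fin r → Fin d → Vec n, z = ∑ i, elem (x i)}

/-- `x` is a best rank-`r` approximation of `z` for the Hilbert–Schmidt norm. -/
def IsBestRankApprox {d n : ℕ} (r : ℕ) (z x : Tens d n) : Prop :=
  tensorRank x ≤ r ∧ ∀ y : Tens d n, tensorRank y ≤ r → HS (z - x) ≤ HS (z - y)

/-- The decomposable symmetric tensor `x₁ ∨ ⋯ ∨ x_d`. -/
def symElem {d n : ℕ} (x : Fin d → Vec n) : Tens d n :=
  (1 / (d.factorial : ℝ)) • ∑ η : Equiv.Perm (Fin d), elem (fun i => x (η i))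

/-- The family `(v, …, v, w, …, w)` of length `d` that starts with `j` copies of `v`. -/
def mixed {n : ℕ} (d j : ℕ) (v w : Vec n) : Fin d → Vec n :=
  fun i => if (i : ℕ) < j then v else w

/-- `∑_{l=0}^{⌊d/2⌋} (d choose 2l) (-1)^l (∨^{2l} v) ∨ (∨^{d-2l} w)`. -/
def alternatingTensor {n : ℕ} (d : ℕ) (v w : Vec n) : Tens d n :=
  ∑ l ∈ Finset.range (d / 2 + 1),
    ((d.choose (2 * l) : ℝ) * (-1) ^ l) • symElem (mixed d (2 * l) v w)

/-- The unit vector `u / ‖u‖` (for `u ≠ 0`). -/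
def unit {n : ℕ} (u : Vec n) : Vec n := ‖u‖⁻¹ • u

/-- For linearly independent unit vectors `x`, `y`: the vector obtained by rotating `x` in the
plane spanned by `x` and `y` by the angle `t`, in the direction of `y` (and by `|t|` in the
opposite direction if `t < 0`). -/
def rotateToward {n : ℕ} (x y : Vec n) (t : ℝ) : Vec n :=
  Real.cos t • x + Real.sin t • unit (y - inner ℝ x y • x)

open scoped Classical in
/-- The second step of the procedure. From a unit vector `a` and a list `u₁, …, u_m` of unit
vectors it computes `(±a, y)`. The list is worked off from its last entry: if `l` entries have
been merged into `y`, then the next entry `u` is rotated towards `y` by `l θ / (l + 1)`, where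
`θ` is the angle between `u` and `y`. If `u = y` or `u = -y`, then `y` is kept, and in the
second case the sign of `a` is changed. The value at the empty list is irrelevant. -/
def mergeTail {n : ℕ} (a : Vec n) : List (Vec n) → Vec n × Vec n
  | [] => (a, 0)
  | [u] => (a, u)
  | u :: u' :: us =>
    let l : ℕ := (u' :: us).length
    let p := mergeTail a (u' :: us)
    if LinearIndependent ℝ ![u, p.2] then
      (p.1, rotateToward u p.2 (l * (InnerProductGeometry.angle u p.2 / (l + 1))))
    else if u = -p.2 then (-p.1, p.2)
    else p

/-- The two orthonormal vectors `v`, `w` and the sign `ε` that the procedure returns. -/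
structure Recovered (n : ℕ) where
  v : Vec n
  w : Vec n
  ε : ℝ

open scoped Classical in
/-- The rotation procedure, applied to a list `x₁, …, x_d` of unit vectors with `x₁`, `x₂`
linearly independent. With `(a, y)` the outcome of `mergeTail` and `b = x₂`, put
`f₁ = (a + b) / ‖a + b‖` and `f₂ = (a - b) / ‖a - b‖`. If `f₁` and `y` are linearly dependent,
return `v = f₂`, `w = y` and the sign `-1`. Otherwise let `θ` be the angle between `f₁` and `y`
and `α = (θ - π / 2) / d`, rotate `f₁` towards `y` by `(d - 2) α` to get `v`, rotate `y` towards
`f₁` by `2 α` to get `w`, and return the sign `1`. For `d = 2` (no `y`) return `f₁`, `f₂`, `1`.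
The value at shorter lists is irrelevant. -/
def procedure {n : ℕ} : List (Vec n) → Recovered n
  | x₁ :: x₂ :: u :: us =>
    let d : ℕ := us.length + 3
    let p := mergeTail x₁ (u :: us)
    let y := p.2
    let f₁ := unit (p.1 + x₂)
    let f₂ := unit (p.1 - x₂)
    let α : ℝ := (InnerProductGeometry.angle f₁ y - Real.pi / 2) / d
    if LinearIndependent ℝ ![f₁, y] then
      ⟨rotateToward f₁ y (((d : ℝ) - 2) * α), rotateToward y f₁ (2 * α), 1⟩
    else ⟨f₂, y, -1⟩
  | [x₁, x₂] => ⟨unit (x₁ + x₂), unit (x₁ - x₂), 1⟩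
  | _ => ⟨0, 0, 1⟩

/-- The first two entries of the list exist and are linearly independent. -/
def FirstTwoIndep {n : ℕ} : List (Vec n) → Prop
  | x₁ :: x₂ :: _ => LinearIndependent ℝ ![x₁, x₂]
  | _ => False

/-- The list `x_{η(1)} / ‖x_{η(1)}‖, …, x_{η(d)} / ‖x_{η(d)}‖`. -/
def reordered {d n : ℕ} (x : Fin d → Vec n) (η : Equiv.Perm (Fin d)) : List (Vec n) :=
  List.ofFn fun i => unit (x (η i))

/-- The output of the procedure on the vectors `x₁, …, x_d`, normalized and reordered by `η`. -/
def recover {d n : ℕ} (x : Fin d → Vec n) (η : Equiv.Perm (Fin d)) : Recovered n :=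
  procedure (reordered x η)

/-- The tensor that is computed from the vectors `x₁, …, x_d` (reordered by `η`) alone:
`-ε ‖x₁‖ ⋯ ‖x_d‖ ∑_l (d choose 2l) (-1)^l (∨^{2l} v) ∨ (∨^{d-2l} w)`. -/
def recoveredTensor {d n : ℕ} (x : Fin d → Vec n) (η : Equiv.Perm (Fin d)) : Tens d n :=
  (-(recover x η).ε * ∏ i, ‖x i‖) • alternatingTensor d (recover x η).v (recover x η).w

end SymTensor

end

noncomputable section

namespace SymTensor

/-! Comparing `z` with multiples of elementary tensors shows that `L z`, with `x` normalized to unit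
vectors, takes its maximum `λ = ∏ ‖x i‖` there (`IsBestRankApprox.L_self`,
`IsBestRankApprox.abs_L_le`). When a linear form attains its norm `λ` at a unit vector `a`, it
equals `λ ⟨a, ·⟩`. Applied in single slots and combined with symmetry, this forces all the `x i`
into one plane (`IsSymmTrilinear.mem_span`, `IsSymmBounded.mem_span`).

Identify that plane with `ℂ`, the unit vectors becoming unit complex numbers `t i`. The same
principle and an induction on `d` give `L z y = λ Re ∏ conj (t i) * y i`
(`IsSymmBounded.eq_re_prod`). So on the plane the form depends only on `λ` and the single number `∏
t i`, and any unit tuple with the same product is again a maximizer.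

Rotations become multiplications by phases, and the procedure is arranged to preserve the product up
to the sign `ε`: it returns `p = ±i q` with `p² q^(d-2) = ε ∏ t i` (`mergeTail_map`,
`procedure_map`). Since `p² = -q²`, this says `∏ t i = -ε q^d`, hence `L z y = -ελ Re ∏ conj q * y
i`. Here `conj q * y` has real part `⟨w, y⟩` and imaginary part `±⟨v, y⟩`. Expanding the product
over subsets and taking the real part keeps the subsets of even size and yields the alternating sum
(`L_alternatingTensor`). If `n = 2` the plane is the whole space, and `L_injective` recovers the
tensor itself. -/

/-! ### The Hilbert–Schmidt inner product and symmetric tensors -/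

theorem hsInner_comm {d n : ℕ} (z w : Tens d n) : hsInner z w = hsInner w z := by
  induction z using PiTensorProduct.induction_on with
  | smul_tprod r x =>
    induction w using PiTensorProduct.induction_on with
    | smul_tprod s y =>
      have h := hsInner_elem x y
      have h' := hsInner_elem y x
      simp only [elem] at h h'
      simp only [map_smul, LinearMap.smul_apply, h, h', smul_eq_mul, real_inner_comm]
      ring
    | add a b ha hb => rw [map_add, ha, hb, map_add, LinearMap.add_apply]
  | add a b ha hb => simp [ha, hb]

/-- Tensor products of the standard basis vectors are orthonormal for `hsInner`; positive
definiteness is read off from the coordinates. -/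
theorem exists_hsInner_eq_sum_sq {d n : ℕ} : ∃ b : Module.Basis (Fin d → Fin n) ℝ (Tens d n),
    ∀ z, hsInner z z = ∑ p, b.repr z p ^ 2 := by
  classical
  let e : Module.Basis (Fin n) ℝ (Vec n) := (EuclideanSpace.basisFun (Fin n) ℝ).toBasis
  let b := Basis.piTensorProduct (R := ℝ) (fun _ : Fin d => e)
  refine ⟨b, fun z => ?_⟩
  have hb : ∀ p q, hsInner (b p) (b q) = if p = q then 1 else 0 := by
    intro p q
    have := hsInner_elem (fun i : Fin d => e (p i)) (fun i => e (q i))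
    rw [elem, elem] at this
    rw [Basis.piTensorProduct_apply, Basis.piTensorProduct_apply, this]
    have h1 : ∀ i, inner ℝ (e (p i)) (e (q i)) = if p i = q i then (1 : ℝ) else 0 := by
      intro i
      have := orthonormal_iff_ite.mp (EuclideanSpace.basisFun (Fin n) ℝ).orthonormal (p i) (q i)
      simpa [e] using this
    simp only [h1, Finset.prod_ite_zero, funext_iff]
    simp
  have key : hsInner (∑ p, b.repr z p • b p) (∑ p, b.repr z p • b p) = ∑ p, b.repr z p ^ 2 := by
    simp only [map_sum, map_smul, LinearMap.sum_apply, LinearMap.smul_apply, hb, smul_eq_mul]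
    simp [sq]
  rwa [b.sum_repr] at key

theorem hsInner_self_nonneg {d n : ℕ} (z : Tens d n) : 0 ≤ hsInner z z := by
  obtain ⟨b, hb⟩ := exists_hsInner_eq_sum_sq (d := d) (n := n)
  rw [hb]
  positivity

theorem eq_zero_of_hsInner_self {d n : ℕ} {z : Tens d n} (h : hsInner z z = 0) : z = 0 := by
  obtain ⟨b, hb⟩ := exists_hsInner_eq_sum_sq (d := d) (n := n)
  rw [hb, Finset.sum_eq_zero_iff_of_nonneg (fun _ _ => sq_nonneg _)] at h
  apply b.repr.injective
  ext p
  simpa using h p (Finset.mem_univ p)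

theorem L_apply {d n : ℕ} (z : Tens d n) (y : Fin d → Vec n) : L z y = hsInner z (elem y) := rfl

theorem L_injective {d n : ℕ} {z z' : Tens d n} (h : ∀ y, L z y = L z' y) : z = z' := by
  have h0 : hsInner (z - z') = 0 := by
    refine PiTensorProduct.ext ?_
    ext y
    have := h y
    simp only [L_apply, elem] at this
    simp [this]
  have := eq_zero_of_hsInner_self (z := z - z') (by rw [h0]; rfl)
  exact sub_eq_zero.mp this

theorem permute_elem {d n : ℕ} (η : Equiv.Perm (Fin d)) (x : Fin d → Vec n) :
    permute η (elem x) = elem (fun i => x (η.symm i)) := by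
  simp [permute, elem]

theorem hsInner_permute {d n : ℕ} (η : Equiv.Perm (Fin d)) (z : Tens d n) (y : Fin d → Vec n) :
    hsInner (permute η z) (elem y) = hsInner z (elem (fun i => y (η i))) := by
  induction z using PiTensorProduct.induction_on with
  | smul_tprod r x =>
    rw [show PiTensorProduct.tprod ℝ x = elem x from rfl, map_smul, permute_elem]
    simp only [map_smul, LinearMap.smul_apply, hsInner_elem]
    congr 1
    rw [← Equiv.prod_comp η]
    exact Finset.prod_congr rfl fun i _ => by rw [Equiv.symm_apply_apply]
  | add a b ha hb => simp [ha, hb]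

theorem IsSymm.L_comp {d n : ℕ} {z : Tens d n} (hz : IsSymm z) (η : Equiv.Perm (Fin d))
    (y : Fin d → Vec n) : L z (fun i => y (η i)) = L z y := by
  rw [L_apply, L_apply, ← hsInner_permute, hz]

theorem tensorRank_elem_le {d n : ℕ} (x : Fin d → Vec n) : tensorRank (elem x) ≤ 1 :=
  Nat.sInf_le ⟨fun _ => x, by simp⟩

theorem smul_elem {d n : ℕ} (c : ℝ) (x : Fin d → Vec n) (i : Fin d) :
    c • elem x = elem (Function.update x i (c • x i)) := by
  simp [elem, MultilinearMap.map_update_smul]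

theorem hsInner_sub_elem {d n : ℕ} (z : Tens d n) (c : ℝ) (y : Fin d → Vec n) :
    hsInner (z - c • elem y) (z - c • elem y) =
      hsInner z z - 2 * c * L z y + c ^ 2 * ∏ i, ‖y i‖ ^ 2 := by
  have h : hsInner (elem y) (elem y) = ∏ i, ‖y i‖ ^ 2 := by
    rw [hsInner_elem]
    simp
  simp only [map_sub, map_smul, LinearMap.sub_apply, LinearMap.smul_apply, smul_eq_mul, h,
    L_apply, hsInner_comm (elem y) z]
  ring

/-! ### Best rank-one approximations as maximizers of the multilinear form -/

section Best

variable {d n : ℕ} {z : Tens d n} {x : Fin d → Vec n}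

/-- The competitor is `c • elem y`. The index `i` provides a factor that absorbs the scalar, so that
the competitor has rank at most one. -/
theorem IsBestRankApprox.quadratic_le (h : IsBestRankApprox 1 z (elem x)) (i : Fin d) (c : ℝ)
    (y : Fin d → Vec n) :
    -2 * L z x + ∏ i, ‖x i‖ ^ 2 ≤ -2 * c * L z y + c ^ 2 * ∏ i, ‖y i‖ ^ 2 := by
  have h1 := h.2 (c • elem y) (by rw [smul_elem c y i]; exact tensorRank_elem_le _)
  rw [HS, HS, Real.sqrt_le_sqrt_iff (hsInner_self_nonneg _), hsInner_sub_elem,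
    ← one_smul ℝ (elem x), hsInner_sub_elem] at h1
  linarith

theorem IsBestRankApprox.L_self (h : IsBestRankApprox 1 z (elem x)) (i : Fin d)
    (hpos : 0 < ∏ i, ‖x i‖) : L z x = (∏ i, ‖x i‖) ^ 2 := by
  -- This scalar minimizes the distance to `z` along the line through `elem x`; the inequality
  -- becomes `(L z x - l)² ≤ 0`.
  have h1 := h.quadratic_le i (L z x / (∏ i, ‖x i‖) ^ 2) x
  rw [Finset.prod_pow] at h1
  set l := (∏ i, ‖x i‖) ^ 2
  have hl : 0 < l := by positivity
  have h2 : -2 * (L z x / l) * L z x + (L z x / l) ^ 2 * l = -(L z x) ^ 2 / l := by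
    field_simp
    ring
  rw [h2, le_div_iff₀ hl] at h1
  nlinarith [sq_nonneg (l - L z x)]

theorem IsBestRankApprox.abs_L_le (h : IsBestRankApprox 1 z (elem x)) (i : Fin d)
    (hpos : 0 < ∏ i, ‖x i‖) (y : Fin d → Vec n) : |L z y| ≤ (∏ i, ‖x i‖) * ∏ i, ‖y i‖ := by
  have h1 := fun c => h.quadratic_le i c y
  rw [h.L_self i hpos] at h1
  simp only [Finset.prod_pow] at h1
  have h2 := discrim_le_zero (a := (∏ i, ‖y i‖) ^ 2) (b := -2 * L z y) (c := (∏ i, ‖x i‖) ^ 2)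
    (fun c => by linarith [h1 c])
  rw [discrim] at h2
  have h3 : 0 ≤ (∏ i, ‖x i‖) * ∏ i, ‖y i‖ := by positivity
  apply abs_le_of_sq_le_sq _ h3
  nlinarith

/-- Both approximations have squared distance `‖z‖² - λ²` to `z`. -/
theorem IsBestRankApprox.of_L_eq (h : IsBestRankApprox 1 z (elem x)) (i : Fin d)
    (hpos : 0 < ∏ i, ‖x i‖) {ε : ℝ} (hε : ε = 1 ∨ ε = -1) {y : Fin d → Vec n}
    (hy : ∀ i, ‖y i‖ = 1) (hL : L z y = ε * ∏ i, ‖x i‖) :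
    IsBestRankApprox 1 z ((ε * ∏ i, ‖x i‖) • elem y) := by
  refine ⟨by rw [smul_elem _ y i]; exact tensorRank_elem_le _, fun w hw => le_trans ?_ (h.2 w hw)⟩
  have hε2 : ε ^ 2 = 1 := by rcases hε with rfl | rfl <;> norm_num
  rw [HS, HS]
  apply Real.sqrt_le_sqrt
  rw [hsInner_sub_elem, ← one_smul ℝ (elem x), hsInner_sub_elem, hL, h.L_self i hpos]
  simp only [hy, Finset.prod_pow]
  simp
  nlinarith

end Best

/-! ### Forms attaining their norm; the maximizing vectors lie in a plane -/

section Norming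

variable {E : Type*} [NormedAddCommGroup E] [InnerProductSpace ℝ E]

/-- First-order condition at a maximum: moving from `x` by `s • y'` orthogonally to `x` changes the
norm only to second order in `s`, so `f` must vanish on `y'`. -/
theorem eq_mul_inner_of_norming {f : E → ℝ} (hf : IsLinearMap ℝ f) {l : ℝ} (hl : 0 < l)
    (hb : ∀ y, |f y| ≤ l * ‖y‖) {x : E} (hx : ‖x‖ = 1) (hfx : f x = l) (y : E) :
    f y = l * inner ℝ x y := by
  set y' := y - inner ℝ x y • x with hy'
  have hxx : inner ℝ x x = (1 : ℝ) := by rw [real_inner_self_eq_norm_sq, hx]; norm_num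
  have hort : inner ℝ x y' = 0 := by
    rw [hy', inner_sub_right, inner_smul_right, hxx]
    ring
  have hfy' : f y' = f y - inner ℝ x y * l := by
    rw [hy', hf.map_sub, hf.map_smul, hfx, smul_eq_mul]
  suffices f y' = 0 by linarith
  -- This is the squared bound at `x + s • y'`. The constant terms cancel, so the discriminant is
  -- the square of the linear coefficient.
  have key : ∀ s : ℝ, 0 ≤ (l ^ 2 * ‖y'‖ ^ 2 - f y' ^ 2) * (s * s) + (-2 * l * f y') * s + 0 := by
    intro s
    have h1 := hb (x + s • y')
    rw [hf.map_add, hf.map_smul, hfx, smul_eq_mul] at h1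
    have h2 := pow_le_pow_left₀ (abs_nonneg _) h1 2
    rw [sq_abs, mul_pow, norm_add_sq_real, inner_smul_right, hort, norm_smul, hx, mul_pow,
      Real.norm_eq_abs, sq_abs] at h2
    nlinarith
  have := discrim_le_zero key
  rw [discrim] at this
  have h3 : (2 * l * f y') ^ 2 = 0 := by nlinarith [sq_nonneg (2 * l * f y')]
  have h4 : 2 * l * f y' = 0 := by simpa using h3
  rcases mul_eq_zero.mp h4 with h | h
  · linarith
  · exact h

/-- A symmetric trilinear form, bounded by `l` on unit vectors. -/
structure IsSymmTrilinear (l : ℝ) (m : E → E → E → ℝ) : Prop where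
  lin : ∀ b c, IsLinearMap ℝ fun a => m a b c
  swap₁₂ : ∀ a b c, m a b c = m b a c
  swap₂₃ : ∀ a b c, m a b c = m a c b
  bound : ∀ a b c, |m a b c| ≤ l * (‖a‖ * ‖b‖ * ‖c‖)

namespace IsSymmTrilinear

variable {l : ℝ} {m : E → E → E → ℝ}

theorem add₁ (h : IsSymmTrilinear l m) (a a' b c : E) : m (a + a') b c = m a b c + m a' b c :=
  (h.lin b c).map_add a a'

theorem smul₁ (h : IsSymmTrilinear l m) (r : ℝ) (a b c : E) : m (r • a) b c = r * m a b c :=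
  (h.lin b c).map_smul r a

theorem add₂ (h : IsSymmTrilinear l m) (a b b' c : E) : m a (b + b') c = m a b c + m a b' c := by
  rw [h.swap₁₂, h.add₁, h.swap₁₂ b, h.swap₁₂ b']

theorem smul₂ (h : IsSymmTrilinear l m) (r : ℝ) (a b c : E) : m a (r • b) c = r * m a b c := by
  rw [h.swap₁₂, h.smul₁, h.swap₁₂ b]

theorem smul₃ (h : IsSymmTrilinear l m) (r : ℝ) (a b c : E) : m a b (r • c) = r * m a b c := by
  rw [h.swap₂₃, h.smul₂, h.swap₂₃ a c]

theorem norming₁ (h : IsSymmTrilinear l m) (hl : 0 < l) {a b c : E} (ha : ‖a‖ = 1) (hb : ‖b‖ = 1)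
    (hc : ‖c‖ = 1) (habc : m a b c = l) (y : E) : m y b c = l * inner ℝ a y :=
  eq_mul_inner_of_norming (h.lin b c) hl (fun y => by simpa [hb, hc] using h.bound y b c) ha habc y

theorem norming₂ (h : IsSymmTrilinear l m) (hl : 0 < l) {a b c : E} (ha : ‖a‖ = 1) (hb : ‖b‖ = 1)
    (hc : ‖c‖ = 1) (habc : m a b c = l) (y : E) : m a y c = l * inner ℝ b y := by
  rw [h.swap₁₂]
  exact h.norming₁ hl hb ha hc (by rw [h.swap₁₂, habc]) y

theorem norming₃ (h : IsSymmTrilinear l m) (hl : 0 < l) {a b c : E} (ha : ‖a‖ = 1) (hb : ‖b‖ = 1)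
    (hc : ‖c‖ = 1) (habc : m a b c = l) (y : E) : m a b y = l * inner ℝ c y := by
  rw [h.swap₂₃]
  exact h.norming₂ hl ha hc hb (by rw [h.swap₂₃, habc]) y

theorem add_self (h : IsSymmTrilinear l m) (hl : 0 < l) {a b c : E} (ha : ‖a‖ = 1) (hb : ‖b‖ = 1)
    (hc : ‖c‖ = 1) (habc : m a b c = l) : m (a + b) (a + b) c = l * ‖a + b‖ ^ 2 := by
  rw [h.add₁, h.norming₂ hl ha hb hc habc, h.swap₁₂ b, h.norming₁ hl ha hb hc habc,
    ← real_inner_self_eq_norm_sq, inner_add_left]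
  ring

theorem sub_self (h : IsSymmTrilinear l m) (hl : 0 < l) {a b c : E} (ha : ‖a‖ = 1) (hb : ‖b‖ = 1)
    (hc : ‖c‖ = 1) (habc : m a b c = l) : m (a - b) (a - b) c = -l * ‖a - b‖ ^ 2 := by
  rw [(h.lin _ _).map_sub, h.norming₂ hl ha hb hc habc, h.swap₁₂ b, h.norming₁ hl ha hb hc habc,
    ← real_inner_self_eq_norm_sq, inner_sub_left a b]
  ring

/-- By `add_self`, the normalized sum `g` of `f` and `x` satisfies `m g g f = l`, hence `m g g x = l
⟨f, x⟩`. Expanding `m (f + x) (f + x) x` leaves `m x x x` as the only unknown. -/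
theorem cube (h : IsSymmTrilinear l m) (hl : 0 < l) {f x : E} (hf : ‖f‖ = 1) (hx : ‖x‖ = 1)
    (hfx : m f f x = l) : m x x x = l * (2 * inner ℝ f x ^ 2 - 1) := by
  have hff : inner ℝ f f = (1 : ℝ) := by rw [real_inner_self_eq_norm_sq, hf]; norm_num
  have hxx : inner ℝ x x = (1 : ℝ) := by rw [real_inner_self_eq_norm_sq, hx]; norm_num
  by_cases h0 : f + x = 0
  · have hxf : f = (-1 : ℝ) • x := by rw [neg_one_smul]; exact eq_neg_of_add_eq_zero_left h0
    have hi : inner ℝ f x = (-1 : ℝ) := by rw [hxf, inner_smul_left, hxx]; simp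
    rw [hi]
    rw [hxf, h.smul₁, h.smul₂] at hfx
    linarith
  · have hn : ‖f + x‖ ≠ 0 := norm_ne_zero_iff.mpr h0
    set g := ‖f + x‖⁻¹ • (f + x) with hg
    have hgn : ‖g‖ = 1 := by rw [hg, norm_smul, norm_inv, norm_norm, inv_mul_cancel₀ hn]
    have hgf : m g g f = l := by
      have h1 := h.add_self hl hf hx hf (by rw [h.swap₂₃, hfx])
      rw [hg, h.smul₁, h.smul₂, h1]
      field_simp
    have h2 := h.norming₃ hl hgn hgn hf hgf x
    have h3 : m f x x = l * inner ℝ f x := h.norming₂ hl hf hf hx hfx x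
    have hn2 : ‖f + x‖ ^ 2 = 2 + 2 * inner ℝ f x := by
      rw [norm_add_sq_real, hf, hx]
      ring
    have h4 : m (f + x) (f + x) x = ‖f + x‖ ^ 2 * (l * inner ℝ f x) := by
      rw [← h2, hg, h.smul₁, h.smul₂]
      field_simp
    rw [h.add₁, h.add₂, h.add₂, hfx, h.swap₁₂ x f, h3, hn2] at h4
    linarith

/-- The normalized sum `f` and difference `g` of `a`, `b` are orthonormal with `m f f c = l` and `m
g g (-c) = l`. Computing `m c c c` by `cube` from each gives `⟨f, c⟩² + ⟨g, c⟩² = 1`, which is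
equality in Bessel's inequality for the unit vector `c`. -/
theorem mem_span (h : IsSymmTrilinear l m) (hl : 0 < l) {a b c : E} (ha : ‖a‖ = 1) (hb : ‖b‖ = 1)
    (hc : ‖c‖ = 1) (habc : m a b c = l) (hab : a + b ≠ 0) (hab' : a - b ≠ 0) :
    c ∈ Submodule.span ℝ {a, b} := by
  have hn : ‖a + b‖ ≠ 0 := norm_ne_zero_iff.mpr hab
  have hn' : ‖a - b‖ ≠ 0 := norm_ne_zero_iff.mpr hab'
  set f := ‖a + b‖⁻¹ • (a + b) with hf
  set g := ‖a - b‖⁻¹ • (a - b) with hg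
  have hfn : ‖f‖ = 1 := by rw [hf, norm_smul, norm_inv, norm_norm, inv_mul_cancel₀ hn]
  have hgn : ‖g‖ = 1 := by rw [hg, norm_smul, norm_inv, norm_norm, inv_mul_cancel₀ hn']
  have hfg : inner ℝ f g = (0 : ℝ) := by
    rw [hf, hg, inner_smul_left, inner_smul_right,
      (real_inner_add_sub_eq_zero_iff a b).mpr (by rw [ha, hb])]
    simp
  have h1 : m f f c = l := by
    rw [hf, h.smul₁, h.smul₂, h.add_self hl ha hb hc habc]
    field_simp
  have h2 : m g g ((-1 : ℝ) • c) = l := by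
    rw [hg, h.smul₁, h.smul₂, h.smul₃, h.sub_self hl ha hb hc habc]
    field_simp
  have h3 := h.cube hl hfn hc h1
  have h4 := h.cube hl hgn (by rw [norm_smul, hc]; norm_num) h2
  rw [h.smul₁, h.smul₂, h.smul₃, h3, inner_smul_right] at h4
  have h5 : inner ℝ f c ^ 2 + inner ℝ g c ^ 2 = (1 : ℝ) :=
    mul_left_cancel₀ hl.ne' (by linarith)
  have hff : inner ℝ f f = (1 : ℝ) := by rw [real_inner_self_eq_norm_sq, hfn]; norm_num
  have hgg : inner ℝ g g = (1 : ℝ) := by rw [real_inner_self_eq_norm_sq, hgn]; norm_num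
  have hcc : inner ℝ c c = (1 : ℝ) := by rw [real_inner_self_eq_norm_sq, hc]; norm_num
  have h6 : c - (inner ℝ f c • f + inner ℝ g c • g) = 0 := by
    rw [← inner_self_eq_zero (𝕜 := ℝ)]
    simp only [inner_sub_left, inner_sub_right, inner_add_left, inner_add_right, inner_smul_left,
      inner_smul_right, hff, hgg, hcc, hfg, real_inner_comm f g, real_inner_comm f c,
      real_inner_comm g c, RCLike.conj_to_real]
    linarith
  have hspan : f ∈ Submodule.span ℝ {a, b} ∧ g ∈ Submodule.span ℝ {a, b} := by
    have h7 : a ∈ Submodule.span ℝ {a, b} := Submodule.subset_span (by simp)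
    have h8 : b ∈ Submodule.span ℝ {a, b} := Submodule.subset_span (by simp)
    exact ⟨Submodule.smul_mem _ _ (add_mem h7 h8), Submodule.smul_mem _ _ (sub_mem h7 h8)⟩
  rw [sub_eq_zero.mp h6]
  exact add_mem (Submodule.smul_mem _ _ hspan.1) (Submodule.smul_mem _ _ hspan.2)

end IsSymmTrilinear

theorem cons_cons_swap {F : Type*} {d : ℕ} (a b : F) (r : Fin d → F) :
    (fun i => (Fin.cons a (Fin.cons b r : Fin (d + 1) → F) : Fin (d + 2) → F)
      (Equiv.swap 0 1 i)) = Fin.cons b (Fin.cons a r : Fin (d + 1) → F) := by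
  ext i
  refine Fin.cases ?_ (fun i => ?_) i
  · simp
  refine Fin.cases ?_ (fun i => ?_) i
  · simp
  have h1 : i.succ.succ ≠ (1 : Fin (d + 2)) := fun h => Fin.succ_ne_zero _ (Fin.succ_injective _ h)
  rw [Equiv.swap_apply_of_ne_of_ne (Fin.succ_ne_zero _) h1]
  simp

/-- A symmetric multilinear form, bounded by `l` on unit vectors. -/
structure IsSymmBounded {d : ℕ} (l : ℝ) (M : MultilinearMap ℝ (fun _ : Fin d => E) ℝ) :
    Prop where
  symm : ∀ (σ : Equiv.Perm (Fin d)) (y : Fin d → E), M (fun i => y (σ i)) = M y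
  bound : ∀ y, |M y| ≤ l * ∏ i, ‖y i‖

namespace IsSymmBounded

variable {l : ℝ}

theorem curryLeft {d : ℕ} {M : MultilinearMap ℝ (fun _ : Fin (d + 1) => E) ℝ}
    (h : IsSymmBounded l M) {a : E} (ha : ‖a‖ = 1) :
    IsSymmBounded (E := E) l (M.curryLeft a) where
  symm σ y := by
    rw [MultilinearMap.curryLeft_apply, MultilinearMap.curryLeft_apply,
      -- This permutation fixes `0` and acts as `σ` on the remaining slots.
      ← h.symm (Equiv.Perm.decomposeFin.symm (0, σ)) (Fin.cons a y)]
    congr 1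
    ext i
    refine Fin.cases ?_ (fun i => ?_) i <;> simp
  bound y := by
    have := h.bound (Fin.cons a y)
    rwa [Fin.prod_univ_succ, Fin.cons_zero, ha, one_mul] at this

theorem trilinear {d : ℕ} {M : MultilinearMap ℝ (fun _ : Fin (d + 3) => E) ℝ}
    (h : IsSymmBounded l M) {r : Fin d → E} (hr : ∀ i, ‖r i‖ = 1) :
    IsSymmTrilinear l
      (fun a b c => M (Fin.cons a (Fin.cons b (Fin.cons c r) : Fin (d + 2) → E))) where
  lin b c := ⟨fun a a' => M.cons_add _ _ _, fun s a => M.cons_smul _ _ _⟩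
  swap₁₂ a b c := by
    rw [← h.symm (Equiv.swap 0 1), cons_cons_swap]
  swap₂₃ a b c := by
    rw [← h.symm (Equiv.Perm.decomposeFin.symm (0, Equiv.swap 0 1))
      (Fin.cons a (Fin.cons b (Fin.cons c r)))]
    congr 1
    ext i
    refine Fin.cases ?_ (fun i => ?_) i
    · simp
    · simpa using congrFun (cons_cons_swap b c r) i
  bound a b c := by
    have := h.bound (Fin.cons a (Fin.cons b (Fin.cons c r) : Fin (d + 2) → E))
    simpa [Fin.prod_univ_succ, hr, mul_assoc] using this

/-- The vectors at which a symmetric form attains its norm lie in a plane. -/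
theorem mem_span {d : ℕ} {M : MultilinearMap ℝ (fun _ : Fin (d + 2) => E) ℝ}
    (h : IsSymmBounded l M) (hl : 0 < l) {t : Fin (d + 2) → E} (ht : ∀ i, ‖t i‖ = 1)
    (hMt : M t = l) (hab : t 0 + t 1 ≠ 0) (hab' : t 0 - t 1 ≠ 0) (k : Fin (d + 2)) :
    t k ∈ Submodule.span ℝ {t 0, t 1} := by
  by_cases hk0 : k = 0
  · exact Submodule.subset_span (by simp [hk0])
  by_cases hk1 : k = 1
  · exact Submodule.subset_span (by simp [hk1])
  rcases d with _ | d
  · fin_cases k <;> simp_all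
  -- Exchange slot `k` with slot 2 and freeze all later slots, which leaves a trilinear form.
  set j : Fin (d + 3) := Fin.succ (Fin.succ 0)
  set s : Fin (d + 3) → E := fun i => t (Equiv.swap j k i)
  have hs : M s = l := by rw [h.symm, hMt]
  have hs0 : s 0 = t 0 := by
    simp only [s]
    rw [Equiv.swap_apply_of_ne_of_ne (Fin.succ_ne_zero _).symm (Ne.symm hk0)]
  have hs1 : s 1 = t 1 := by
    simp only [s]
    have h1 : (1 : Fin (d + 3)) ≠ j := fun e => Fin.succ_ne_zero _ (Fin.succ_injective _ e.symm)
    rw [Equiv.swap_apply_of_ne_of_ne h1 (Ne.symm hk1)]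
  have hs2 : s j = t k := by simp [s]
  have hsn : ∀ i, ‖s i‖ = 1 := fun i => ht _
  have htri := h.trilinear (r := fun i => s i.succ.succ.succ) (fun i => hsn _)
  rw [← hs0, ← hs1, ← hs2]
  refine htri.mem_span hl (hsn 0) (hsn 1) (hsn j) ?_ (by rwa [hs0, hs1]) (by rwa [hs0, hs1])
  rw [← hs]
  congr 1
  ext i
  refine Fin.cases rfl (fun i => ?_) i
  refine Fin.cases rfl (fun i => ?_) i
  refine Fin.cases rfl (fun i => rfl) i

end IsSymmBounded

end Norming

/-! ### Symmetric forms on the plane `ℂ` -/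

section ComplexForms

open ComplexConjugate

/-- Cramer's rule, since `(conj p * q).im` is the determinant of `p`, `q` over `ℝ`. -/
theorem exists_eq_add_of_im_ne_zero {p q : ℂ} (h : (conj p * q).im ≠ 0) (a : ℂ) :
    ∃ α β : ℝ, a = α • p + β • q := by
  simp only [Complex.mul_im, Complex.conj_re, Complex.conj_im] at h
  refine ⟨(a.re * q.im - a.im * q.re) / (p.re * q.im + -p.im * q.re),
    (p.re * a.im - p.im * a.re) / (p.re * q.im + -p.im * q.re), ?_⟩
  apply Complex.ext <;>
    simp only [Complex.add_re, Complex.add_im, Complex.smul_re, Complex.smul_im, smul_eq_mul] <;>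
    rw [div_mul_eq_mul_div, div_mul_eq_mul_div, ← add_div, eq_div_iff h] <;> ring

theorem conj_mul_self_of_norm {p : ℂ} (h : ‖p‖ = 1) : conj p * p = 1 := by
  rw [Complex.conj_mul', h]
  norm_num

namespace IsSymmBounded

variable {l : ℝ}

/-- With `r` frozen, the norming principle determines the form whenever one argument is `p` or `q`;
these two numbers span `ℂ` over `ℝ`. -/
theorem eq_re_of_two {d : ℕ} {M : MultilinearMap ℝ (fun _ : Fin (d + 2) => ℂ) ℝ}
    (h : IsSymmBounded l M) (hl : 0 < l) {p q : ℂ} {r : Fin d → ℂ} (hp : ‖p‖ = 1) (hq : ‖q‖ = 1)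
    (hr : ∀ i, ‖r i‖ = 1) (hpq : (conj p * q).im ≠ 0)
    (hM : M (Fin.cons p (Fin.cons q r : Fin (d + 1) → ℂ)) = l) (a b : ℂ) :
    M (Fin.cons a (Fin.cons b r : Fin (d + 1) → ℂ)) = l * (conj p * conj q * (a * b)).re := by
  have hswap : ∀ a b, M (Fin.cons a (Fin.cons b r : Fin (d + 1) → ℂ)) =
      M (Fin.cons b (Fin.cons a r : Fin (d + 1) → ℂ)) := fun a b => by
    rw [← h.symm (Equiv.swap 0 1), cons_cons_swap]
  have key : ∀ u v : ℂ, ‖u‖ = 1 → ‖v‖ = 1 →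
      M (Fin.cons u (Fin.cons v r : Fin (d + 1) → ℂ)) = l →
      ∀ y, M (Fin.cons y (Fin.cons v r : Fin (d + 1) → ℂ)) = l * (conj u * y).re := by
    intro u v hu hv huv y
    have := eq_mul_inner_of_norming
      (f := fun y => M (Fin.cons y (Fin.cons v r : Fin (d + 1) → ℂ)))
      ⟨fun a a' => M.cons_add _ _ _, fun s a => M.cons_smul _ _ _⟩ hl
      (fun y => by
        have := h.bound (Fin.cons y (Fin.cons v r : Fin (d + 1) → ℂ))
        simpa [Fin.prod_univ_succ, hr, hv] using this) hu huv y
    rw [this, Complex.inner, mul_comm y]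
  obtain ⟨α, β, rfl⟩ := exists_eq_add_of_im_ne_zero hpq a
  rw [M.cons_add, M.cons_smul, M.cons_smul, hswap p b, hswap q b, key p q hp hq hM,
    key q p hq hp (by rw [hswap, hM])]
  have e : conj p * conj q * ((α • p + β • q) * b) = α • (conj q * b) + β • (conj p * b) := by
    rw [Complex.real_smul, Complex.real_smul, Complex.real_smul, Complex.real_smul]
    linear_combination (conj q * α * b) * conj_mul_self_of_norm hp +
      (conj p * β * b) * conj_mul_self_of_norm hq
  rw [e]
  simp only [Complex.add_re, Complex.smul_re, smul_eq_mul]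
  ring

/-- A symmetric real multilinear form on `ℂ` that attains its norm at a tuple of unit vectors,
two of which are independent, is the real part of a multiple of the product. -/
theorem eq_re_prod {d : ℕ} {M : MultilinearMap ℝ (fun _ : Fin (d + 2) => ℂ) ℝ}
    (h : IsSymmBounded l M) (hl : 0 < l) {t : Fin (d + 2) → ℂ} (ht : ∀ i, ‖t i‖ = 1)
    (h01 : (conj (t 0) * t 1).im ≠ 0) (hM : M t = l) (y : Fin (d + 2) → ℂ) :
    M y = l * (∏ i, conj (t i) * y i).re := by
  have hcons : ∀ (n : ℕ) (y : Fin (n + 2) → ℂ), y = Fin.cons (y 0)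
      (Fin.cons (y 1) (fun i => y i.succ.succ) : Fin (n + 1) → ℂ) := by
    intro n y
    ext i
    refine Fin.cases rfl (fun i => ?_) i
    refine Fin.cases rfl (fun i => rfl) i
  induction d with
  | zero =>
    have hy := h.eq_re_of_two hl (ht 0) (ht 1) (fun i => ht _) h01 (by rwa [← hcons 0 t])
      (y 0) (y 1)
    rw [Subsingleton.elim (fun i : Fin 0 => t i.succ.succ) (fun i => y i.succ.succ),
      ← hcons 0 y] at hy
    rw [hy, Fin.prod_univ_two]
    congr 2
    ring
  | succ d ih =>
    -- By `eq_re_of_two` the value `l` is also attained after turning `t 0` by `u` and `t 1` by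
    -- `conj u`. Freezing the first slot at `t 0 * u` allows induction as soon as `t 1 * conj u` and
    -- `t 2` are independent, even when `t 1` and `t 2` are not.
    have h1 : ∀ u : ℂ, ‖u‖ = 1 → (conj (t 1 * conj u) * t 2).im ≠ 0 →
        ∀ y : Fin (d + 2) → ℂ, M (Fin.cons (t 0 * u) y) =
          l * (u * ∏ i, conj (t i.succ) * y i).re := by
      intro u hu hu2 y
      have hu' : ‖t 0 * u‖ = 1 := by rw [norm_mul, ht, hu, one_mul]
      have h2 := ih (h.curryLeft hu')
        (t := Fin.cons (t 1 * conj u) (fun i : Fin (d + 1) => t i.succ.succ))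
        (fun i => by
          refine Fin.cases ?_ (fun i => ?_) i
          · simp [ht, hu]
          · simp [ht]) hu2
        (by
          rw [MultilinearMap.curryLeft_apply,
            h.eq_re_of_two hl (ht 0) (ht 1) (fun i => ht _) h01 (by rwa [← hcons _ t])]
          have : conj (t 0) * conj (t 1) * (t 0 * u * (t 1 * conj u)) = 1 := by
            linear_combination (conj (t 1) * t 1 * (conj u * u)) * conj_mul_self_of_norm (ht 0) +
              (conj u * u) * conj_mul_self_of_norm (ht 1) + conj_mul_self_of_norm hu
          rw [this]
          simp) y
      rw [MultilinearMap.curryLeft_apply] at h2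
      rw [h2, Fin.prod_univ_succ, Fin.prod_univ_succ (n := d + 1)]
      congr 2
      simp only [Fin.cons_zero, Fin.cons_succ, map_mul, Complex.conj_conj, Fin.succ_zero_eq_one]
      ring
    -- For `u = w * s` the independence condition reduces to `s.im ≠ 0`. Two real-independent unit
    -- values of `s` are needed so that the frozen vectors `t 0 * u` span `ℂ`: `I` and the rational
    -- point `3/5 + 4/5 I` serve.
    set w := t 1 * conj (t 2) with hw
    have hwn : ‖w‖ = 1 := by simp [hw, ht]
    have h12 : ∀ s : ℂ, conj (t 1 * conj (w * s)) * t 2 = s := by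
      intro s
      simp only [hw, map_mul, Complex.conj_conj]
      linear_combination (s * (conj (t 2) * t 2)) * conj_mul_self_of_norm (ht 1) +
        s * conj_mul_self_of_norm (ht 2)
    have hs : ‖(3 / 5 + 4 / 5 * Complex.I : ℂ)‖ = 1 := by
      have : (3 / 5 + 4 / 5 * Complex.I : ℂ) = ⟨3 / 5, 4 / 5⟩ := by
        apply Complex.ext <;> simp
      rw [this, Complex.norm_def, Complex.normSq_mk]
      norm_num
    have hA := h1 (w * Complex.I) (by simp [hwn]) (by rw [h12]; simp)
    have hB := h1 (w * (3 / 5 + 4 / 5 * Complex.I)) (by rw [norm_mul, hwn, hs, one_mul])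
      (by rw [h12]; norm_num)
    obtain ⟨α, β, hαβ⟩ := exists_eq_add_of_im_ne_zero
      (p := t 0 * (w * Complex.I)) (q := t 0 * (w * (3 / 5 + 4 / 5 * Complex.I))) (by
        have : conj (t 0 * (w * Complex.I)) * (t 0 * (w * (3 / 5 + 4 / 5 * Complex.I))) =
            conj Complex.I * (3 / 5 + 4 / 5 * Complex.I) := by
          simp only [map_mul]
          linear_combination (conj w * w * (conj Complex.I * (3 / 5 + 4 / 5 * Complex.I))) *
            conj_mul_self_of_norm (ht 0) +
            (conj Complex.I * (3 / 5 + 4 / 5 * Complex.I)) * conj_mul_self_of_norm hwn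
        rw [this]
        norm_num) (y 0)
    have hy : M y = M (Fin.cons (α • (t 0 * (w * Complex.I)) +
        β • (t 0 * (w * (3 / 5 + 4 / 5 * Complex.I)))) (Fin.tail y)) := by
      rw [← hαβ, Fin.cons_self_tail]
    rw [hy, M.cons_add, M.cons_smul, M.cons_smul, hA, hB,
      Fin.prod_univ_succ (fun i : Fin (d + 1 + 2) => conj (t i) * y i), hαβ]
    simp only [Fin.tail]
    set P := ∏ i : Fin (d + 2), conj (t i.succ) * y i.succ
    have : conj (t 0) * (α • (t 0 * (w * Complex.I)) +
        β • (t 0 * (w * (3 / 5 + 4 / 5 * Complex.I)))) * P =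
        α • (w * Complex.I * P) + β • (w * (3 / 5 + 4 / 5 * Complex.I) * P) := by
      rw [Complex.real_smul, Complex.real_smul, Complex.real_smul, Complex.real_smul]
      linear_combination (α * (w * Complex.I) * P + β * (w * (3 / 5 + 4 / 5 * Complex.I)) * P) *
        conj_mul_self_of_norm (ht 0)
    rw [this]
    simp only [Complex.add_re, Complex.smul_re, smul_eq_mul]
    ring

end IsSymmBounded
end ComplexForms

/-! ### The rotation procedure in complex coordinates -/

section Plane

open ComplexConjugate

variable {n : ℕ} (ψ : ℂ →ₗᵢ[ℝ] Vec n) {p q : ℂ}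

theorem linearIndependent_map_iff :
    LinearIndependent ℝ ![ψ p, ψ q] ↔ (conj p * q).im ≠ 0 := by
  have h1 : LinearIndependent ℝ ![ψ p, ψ q] ↔ LinearIndependent ℝ ![p, q] := by
    have : ![ψ p, ψ q] = ψ.toLinearMap ∘ ![p, q] := by
      ext i : 1
      fin_cases i <;> rfl
    rw [this, LinearMap.linearIndependent_iff _ (LinearMap.ker_eq_bot.mpr ψ.injective)]
  rw [h1, LinearIndependent.pair_iff]
  simp only [Complex.mul_im, Complex.conj_re, Complex.conj_im, Complex.ext_iff, Complex.add_re,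
    Complex.add_im, Complex.smul_re, Complex.smul_im, smul_eq_mul, Complex.zero_re,
    Complex.zero_im]
  constructor
  · intro h h0
    obtain ⟨h2, h3⟩ := h q.im (-p.im) ⟨by linarith, by ring⟩
    obtain ⟨h4, h5⟩ := h q.re (-p.re) ⟨by ring, by linarith⟩
    have h6 := h 1 1 ⟨by linarith, by linarith⟩
    exact one_ne_zero h6.1
  · rintro h s t ⟨h1, h2⟩
    constructor
    · apply mul_right_cancel₀ h
      linear_combination q.im * h1 - q.re * h2
    · apply mul_right_cancel₀ h
      linear_combination p.re * h2 - p.im * h1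

theorem eq_or_eq_neg_of_im_eq_zero (hp : ‖p‖ = 1) (hq : ‖q‖ = 1) (h : (conj p * q).im = 0) :
    q = p ∨ q = -p := by
  have h1 : conj p * q = ((conj p * q).re : ℂ) := by
    apply Complex.ext <;> simp [h]
  have h2 : ‖conj p * q‖ = 1 := by simp [hp, hq]
  rw [h1, Complex.norm_real, Real.norm_eq_abs] at h2
  have h3 : q = p * (conj p * q) := by linear_combination -q * conj_mul_self_of_norm hp
  rw [h3, h1]
  rcases abs_eq (zero_le_one) |>.mp h2 with h4 | h4 <;> rw [h4] <;> simp

theorem unit_map (c : ℂ) : unit (ψ c) = ψ ((‖c‖⁻¹ : ℝ) • c) := by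
  rw [unit, ψ.norm_map, ψ.map_smul]

theorem inner_map_eq_re (p q : ℂ) : inner ℝ (ψ p) (ψ q) = (conj p * q).re := by
  rw [ψ.inner_map_map, Complex.inner, mul_comm]

theorem cos_angle_map (hp : ‖p‖ = 1) (hq : ‖q‖ = 1) :
    Real.cos (InnerProductGeometry.angle (ψ p) (ψ q)) = (conj p * q).re := by
  rw [InnerProductGeometry.cos_angle, ψ.norm_map, ψ.norm_map, hp, hq, inner_map_eq_re]
  simp

theorem re_sq_add_im_sq (hp : ‖p‖ = 1) (hq : ‖q‖ = 1) :
    (conj p * q).re ^ 2 + (conj p * q).im ^ 2 = 1 := by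
  have h2 : ‖conj p * q‖ = 1 := by simp [hp, hq]
  have := Complex.sq_norm (conj p * q)
  rw [h2, Complex.normSq_apply] at this
  linarith

theorem abs_im_eq_sin_angle (hp : ‖p‖ = 1) (hq : ‖q‖ = 1) :
    |(conj p * q).im| = Real.sin (InnerProductGeometry.angle (ψ p) (ψ q)) := by
  have h1 := InnerProductGeometry.sin_angle_nonneg (ψ p) (ψ q)
  rw [← abs_of_nonneg h1, ← sq_eq_sq_iff_abs_eq_abs, Real.sin_sq, cos_angle_map ψ hp hq]
  linarith [re_sq_add_im_sq hp hq]

theorem eq_mul_add_I (hp : ‖p‖ = 1) :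
    q = p * ((conj p * q).re + (conj p * q).im * Complex.I) := by
  rw [Complex.re_add_im]
  linear_combination -q * conj_mul_self_of_norm hp

/-- Rotation in the oriented plane `ψ ℂ`; `s` records the orientation of the pair `p`, `q`. -/
theorem rotateToward_map (hp : ‖p‖ = 1) (h : (conj p * q).im ≠ 0) {s : ℝ}
    (hs : s * |(conj p * q).im| = (conj p * q).im) (t : ℝ) :
    rotateToward (ψ p) (ψ q) t = ψ (p * Complex.exp (((s * t : ℝ) : ℂ) * Complex.I)) := by
  have habs : |(conj p * q).im| ≠ 0 := abs_ne_zero.mpr h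
  have hss : s = 1 ∨ s = -1 := by
    have : |s| = 1 := by
      apply mul_right_cancel₀ habs
      rw [one_mul, ← abs_abs (conj p * q).im, ← abs_mul, hs, abs_abs]
    exact (abs_eq zero_le_one).mp this
  have h1 : q - (conj p * q).re • p = (conj p * q).im • (p * Complex.I) := by
    nth_rw 1 [eq_mul_add_I (q := q) hp]
    rw [Complex.real_smul, Complex.real_smul]
    ring
  have h2 : unit (ψ q - inner ℝ (ψ p) (ψ q) • ψ p) = ψ (s • (p * Complex.I)) := by
    rw [inner_map_eq_re, ← ψ.map_smul, ← ψ.map_sub, h1, unit_map, norm_smul, smul_smul]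
    congr 2
    rw [norm_mul, hp, Complex.norm_I, Real.norm_eq_abs]
    nth_rw 2 [← hs]
    field_simp
  rw [rotateToward, h2, ← ψ.map_smul, ← ψ.map_smul, ← ψ.map_add, Complex.exp_mul_I,
    ← Complex.ofReal_cos, ← Complex.ofReal_sin]
  congr 1
  rcases hss with rfl | rfl <;> simp <;> ring

/-- Unoriented angles become phases once the sign `s` of `(conj p * q).im` is recorded; exchanging
`p` and `q` reverses it. -/
theorem exists_orientation (hp : ‖p‖ = 1) (hq : ‖q‖ = 1) (h : (conj p * q).im ≠ 0) :
    ∃ s : ℝ, (s = 1 ∨ s = -1) ∧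
      q = p * Complex.exp (((s * InnerProductGeometry.angle (ψ p) (ψ q) : ℝ) : ℂ) * Complex.I) ∧
      (∀ t, rotateToward (ψ p) (ψ q) t =
        ψ (p * Complex.exp (((s * t : ℝ) : ℂ) * Complex.I))) ∧
      ∀ t, rotateToward (ψ q) (ψ p) t =
        ψ (q * Complex.exp (((-s * t : ℝ) : ℂ) * Complex.I)) := by
  have h' : (conj q * p).im = -(conj p * q).im := by
    simp only [Complex.mul_im, Complex.conj_re, Complex.conj_im]
    ring
  have key : ∀ s : ℝ, (s = 1 ∨ s = -1) → s * |(conj p * q).im| = (conj p * q).im →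
      q = p * Complex.exp (((s * InnerProductGeometry.angle (ψ p) (ψ q) : ℝ) : ℂ) * Complex.I) ∧
      (∀ t, rotateToward (ψ p) (ψ q) t =
        ψ (p * Complex.exp (((s * t : ℝ) : ℂ) * Complex.I))) ∧
      ∀ t, rotateToward (ψ q) (ψ p) t =
        ψ (q * Complex.exp (((-s * t : ℝ) : ℂ) * Complex.I)) := by
    intro s hs hsi
    refine ⟨?_, rotateToward_map ψ hp h hsi, rotateToward_map ψ hq
      (by rw [h']; exact neg_ne_zero.mpr h)
      (by rw [h', abs_neg, neg_mul, hsi])⟩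
    nth_rw 1 [eq_mul_add_I (q := q) hp]
    rw [Complex.exp_mul_I, ← Complex.ofReal_cos, ← Complex.ofReal_sin,
      ← cos_angle_map ψ hp hq, ← hsi, abs_im_eq_sin_angle ψ hp hq]
    rcases hs with rfl | rfl <;> simp
  rcases lt_or_gt_of_ne h with h0 | h0
  · exact ⟨-1, Or.inr rfl, key _ (Or.inr rfl) (by rw [abs_of_neg h0]; ring)⟩
  · exact ⟨1, Or.inl rfl, key _ (Or.inl rfl) (by rw [abs_of_pos h0]; ring)⟩

open scoped Classical in
-- The last conjunct is the invariant of Step II: the merged tail is replaced by equal vectors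
-- without changing the total product, a sign being carried by `a'`.
theorem mergeTail_map (a : ℂ) (ts : List ℂ) (hts : ∀ t ∈ ts, ‖t‖ = 1) (hne : ts ≠ []) :
    ∃ a' y : ℂ, mergeTail (ψ a) (ts.map ψ) = (ψ a', ψ y) ∧ (a' = a ∨ a' = -a) ∧ ‖y‖ = 1 ∧
      a' * y ^ ts.length = a * ts.prod := by
  induction ts with
  | nil => exact absurd rfl hne
  | cons u us ih =>
    rcases us with _ | ⟨u', us⟩
    · exact ⟨a, u, by simp [mergeTail], Or.inl rfl, hts u (by simp), by simp⟩
    obtain ⟨a', y, h1, h2, h3, h4⟩ := ih (fun t ht => hts t (by simp [ht])) (by simp)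
    have hu : ‖u‖ = 1 := hts u (by simp)
    rw [List.prod_cons, List.length_cons]
    set m := (u' :: us).length with hm
    have hunfold : mergeTail (ψ a) ((u :: u' :: us).map ψ) =
        if LinearIndependent ℝ ![ψ u, ψ y] then
          (ψ a', rotateToward (ψ u) (ψ y)
            (m * (InnerProductGeometry.angle (ψ u) (ψ y) / (m + 1))))
        else if ψ u = -ψ y then (-ψ a', ψ y) else (ψ a', ψ y) := by
      have hlen : (ψ u' :: us.map ψ).length = m := by simp [hm]
      rw [List.map_cons] at h1
      rw [List.map_cons, List.map_cons, mergeTail, h1, hlen]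
    rw [hunfold]
    have hm0 : ((m : ℝ) + 1) ≠ 0 := by positivity
    split_ifs with hi hneg
    · obtain ⟨s, hs, e1, e2, e3⟩ := exists_orientation ψ hu h3
        ((linearIndependent_map_iff ψ).mp hi)
      refine ⟨a', _, by rw [e2], h2, by rw [norm_mul, hu, Complex.norm_exp_ofReal_mul_I, one_mul], ?_⟩
      set θ := InnerProductGeometry.angle (ψ u) (ψ y)
      -- As `y = u e^{isθ}`, the power is `u^(m+1) e^{ismθ} = u (u e^{isθ})^m`; this explains the
      -- fraction `m / (m + 1)` of the angle.
      have h5 : (u * Complex.exp (((s * (m * (θ / (m + 1))) : ℝ) : ℂ) * Complex.I)) ^ (m + 1) =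
          u * y ^ m := by
        rw [e1, mul_pow, mul_pow, ← Complex.exp_nat_mul, ← Complex.exp_nat_mul, pow_succ]
        have : ((m + 1 : ℕ) : ℂ) * (((s * (m * (θ / (m + 1))) : ℝ) : ℂ) * Complex.I) =
            m * (((s * θ : ℝ) : ℂ) * Complex.I) := by
          have hm1 : ((m : ℂ) + 1) ≠ 0 := by exact_mod_cast hm0
          push_cast
          field_simp
        rw [this]
        ring
      rw [h5]
      linear_combination u * h4
    · have hneg' : u = -y := ψ.injective (by rw [hneg, ψ.map_neg])
      refine ⟨-a', y, by rw [ψ.map_neg], ?_, h3, ?_⟩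
      · rcases h2 with rfl | rfl <;> simp
      · rw [hneg', pow_succ]
        linear_combination -y * h4
    · rw [linearIndependent_map_iff, not_not] at hi
      have hy : y = u := by
        rcases eq_or_eq_neg_of_im_eq_zero hu h3 hi with h | h
        · exact h
        · exact absurd (by rw [h, ψ.map_neg, neg_neg]) hneg
      refine ⟨a', y, rfl, h2, h3, ?_⟩
      rw [pow_succ]
      linear_combination y * h4 + (a * (u' :: us).prod) * hy

/-- The bisector of two unit numbers is a square root of their product, because `conj (a + b) * (a *
b) = a + b`. -/
theorem unit_add_sq {a b : ℂ} (ha : ‖a‖ = 1) (hb : ‖b‖ = 1) (hab : a + b ≠ 0) :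
    ((‖a + b‖⁻¹ : ℝ) • (a + b)) ^ 2 = a * b := by
  have h1 : ((‖a + b‖ : ℝ) : ℂ) ≠ 0 := by exact_mod_cast norm_ne_zero_iff.mpr hab
  have h2 : ((‖a + b‖ : ℝ) : ℂ) ^ 2 = conj (a + b) * (a + b) := (Complex.conj_mul' _).symm
  have h3 : conj (a + b) * (a * b) = a + b := by
    rw [map_add]
    linear_combination b * conj_mul_self_of_norm ha + a * conj_mul_self_of_norm hb
  rw [Complex.real_smul, Complex.ofReal_inv, mul_pow, inv_pow,
    inv_mul_eq_iff_eq_mul₀ (pow_ne_zero 2 h1), h2]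
  linear_combination -(a + b) * h3

theorem norm_unit_complex {c : ℂ} (hc : c ≠ 0) : ‖(‖c‖⁻¹ : ℝ) • c‖ = 1 := by
  rw [norm_smul, norm_inv, norm_norm, inv_mul_cancel₀ (norm_ne_zero_iff.mpr hc)]

theorem exists_sign_of_sq_eq_neg_sq (h : p ^ 2 = -q ^ 2) :
    ∃ τ : ℝ, (τ = 1 ∨ τ = -1) ∧ p = τ * Complex.I * q := by
  have h1 : (p - Complex.I * q) * (p + Complex.I * q) = 0 := by
    linear_combination h - q ^ 2 * Complex.I_sq
  rcases mul_eq_zero.mp h1 with h2 | h2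
  · exact ⟨1, Or.inl rfl, by push_cast; linear_combination h2⟩
  · exact ⟨-1, Or.inr rfl, by push_cast; linear_combination h2⟩

open scoped Classical in
theorem procedure_map (ts : List ℂ) (hts : ∀ t ∈ ts, ‖t‖ = 1) (h2 : FirstTwoIndep (ts.map ψ)) :
    ∃ p q : ℂ, ∃ ε τ : ℝ, procedure (ts.map ψ) = ⟨ψ p, ψ q, ε⟩ ∧ ‖q‖ = 1 ∧
      (ε = 1 ∨ ε = -1) ∧ (τ = 1 ∨ τ = -1) ∧ p = τ * Complex.I * q ∧
      p ^ 2 * q ^ (ts.length - 2) = ε * ts.prod := by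
  -- Orthogonality of unit vectors is encoded as `p² = -q²`, which avoids choosing a sign in each
  -- case.
  suffices h : ∃ p q : ℂ, ∃ ε : ℝ, procedure (ts.map ψ) = ⟨ψ p, ψ q, ε⟩ ∧ ‖q‖ = 1 ∧
      (ε = 1 ∨ ε = -1) ∧ p ^ 2 = -q ^ 2 ∧ p ^ 2 * q ^ (ts.length - 2) = ε * ts.prod by
    obtain ⟨p, q, ε, h1, h2, h3, h4, h5⟩ := h
    obtain ⟨τ, hτ, hp⟩ := exists_sign_of_sq_eq_neg_sq h4
    exact ⟨p, q, ε, τ, h1, h2, h3, hτ, hp, h5⟩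
  rcases ts with _ | ⟨a, _ | ⟨b, us⟩⟩
  · exact absurd h2 (by simp [FirstTwoIndep])
  · exact absurd h2 (by simp [FirstTwoIndep])
  have ha : ‖a‖ = 1 := hts a (by simp)
  have hb : ‖b‖ = 1 := hts b (by simp)
  have him : (conj a * b).im ≠ 0 := (linearIndependent_map_iff ψ).mp h2
  have hadd : a + b ≠ 0 := fun h => him (by
    rw [eq_neg_of_add_eq_zero_right h, mul_neg, conj_mul_self_of_norm ha]
    simp)
  have hsub : a - b ≠ 0 := fun h => him (by
    rw [← sub_eq_zero.mp h, conj_mul_self_of_norm ha]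
    simp)
  have hf₁ : ∀ {a b : ℂ}, unit (ψ a + ψ b) = ψ ((‖a + b‖⁻¹ : ℝ) • (a + b)) := by
    intro a b
    rw [← ψ.map_add, unit_map]
  have hf₂ : ∀ {a b : ℂ}, unit (ψ a - ψ b) = ψ ((‖a - b‖⁻¹ : ℝ) • (a - b)) := by
    intro a b
    rw [← ψ.map_sub, unit_map]
  have hsq₁ : ∀ {a b : ℂ}, ‖a‖ = 1 → ‖b‖ = 1 → a - b ≠ 0 →
      ((‖a - b‖⁻¹ : ℝ) • (a - b)) ^ 2 = -(a * b) := by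
    intro a b ha hb hab
    have := unit_add_sq (a := a) (b := -b) ha (by rw [norm_neg, hb]) (by rwa [← sub_eq_add_neg])
    rw [← sub_eq_add_neg] at this
    rw [this, mul_neg]
  rcases us with _ | ⟨u, us⟩
  · refine ⟨_, _, 1, by rw [List.map_cons, List.map_cons, List.map_nil, procedure, hf₁, hf₂],
      norm_unit_complex hsub, Or.inl rfl, ?_, ?_⟩
    · rw [unit_add_sq ha hb hadd, hsq₁ ha hb hsub, neg_neg]
    · rw [unit_add_sq ha hb hadd]
      simp
  obtain ⟨a', y, e1, e2, hy, e4⟩ := mergeTail_map ψ a (u :: us)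
    (fun t ht => hts t (by simp [List.mem_cons.mp ht])) (by simp)
  have ha' : ‖a'‖ = 1 := by rcases e2 with rfl | rfl <;> simp [ha]
  have hadd' : a' + b ≠ 0 := by
    rcases e2 with rfl | rfl
    · exact hadd
    · intro h
      exact hsub (by linear_combination -h)
  have hsub' : a' - b ≠ 0 := by
    rcases e2 with rfl | rfl
    · exact hsub
    · intro h
      exact hadd (by linear_combination -h)
  set f := (‖a' + b‖⁻¹ : ℝ) • (a' + b) with hf
  set g := (‖a' - b‖⁻¹ : ℝ) • (a' - b) with hg
  have hfn : ‖f‖ = 1 := norm_unit_complex hadd'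
  have hf2 : f ^ 2 = a' * b := unit_add_sq ha' hb hadd'
  have hg2 : g ^ 2 = -(a' * b) := hsq₁ ha' hb hsub'
  set d : ℕ := us.length + 3 with hd
  set α : ℝ := (InnerProductGeometry.angle (ψ f) (ψ y) - Real.pi / 2) / d with hα
  have hunfold : procedure ((a :: b :: u :: us).map ψ) =
      if LinearIndependent ℝ ![ψ f, ψ y] then
        ⟨rotateToward (ψ f) (ψ y) (((d : ℝ) - 2) * α), rotateToward (ψ y) (ψ f) (2 * α), 1⟩
      else ⟨ψ g, ψ y, -1⟩ := by
    rw [List.map_cons] at e1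
    rw [List.map_cons, List.map_cons, List.map_cons, procedure, e1, List.length_map]
    simp only [hf₁, hf₂]
    rfl
  have hlen : (a :: b :: u :: us).length - 2 = us.length + 1 := rfl
  rw [List.length_cons] at e4
  rw [hunfold, hlen, List.prod_cons, List.prod_cons]
  split_ifs with hi
  · obtain ⟨s, hs, h1, h3, h4⟩ := exists_orientation ψ hfn hy ((linearIndependent_map_iff ψ).mp hi)
    set θ := InnerProductGeometry.angle (ψ f) (ψ y)
    have hd0 : (d : ℝ) ≠ 0 := by positivity
    have hdα : (d : ℝ) * α = θ - Real.pi / 2 := by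
      rw [hα]
      field_simp
    refine ⟨_, _, 1, by rw [h3, h4], by rw [norm_mul, hy, Complex.norm_exp_ofReal_mul_I, one_mul],
      Or.inl rfl, ?_, ?_⟩
    · have hq : y * Complex.exp (((-s * (2 * α) : ℝ) : ℂ) * Complex.I) =
          f * Complex.exp (((s * ((d - 2) * α) : ℝ) : ℂ) * Complex.I) *
            Complex.exp (((s * (Real.pi / 2) : ℝ) : ℂ) * Complex.I) := by
        nth_rw 1 [h1]
        rw [mul_assoc, mul_assoc, ← Complex.exp_add, ← Complex.exp_add, ← add_mul, ← add_mul,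
          ← Complex.ofReal_add, ← Complex.ofReal_add]
        rw [show s * θ + -s * (2 * α) = s * ((d - 2) * α) + s * (Real.pi / 2) by
          linear_combination -s * hdα]
      have hπ : Complex.exp (((s * (Real.pi / 2) : ℝ) : ℂ) * Complex.I) ^ 2 = -1 := by
        rw [← Complex.exp_nat_mul]
        rcases hs with rfl | rfl
        · rw [← Complex.exp_pi_mul_I]
          congr 1
          push_cast
          ring
        · rw [show ((2 : ℕ) : ℂ) * (((-1 * (Real.pi / 2) : ℝ) : ℂ) * Complex.I) =
            -(Real.pi * Complex.I) by push_cast; ring, Complex.exp_neg, Complex.exp_pi_mul_I]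
          norm_num
      rw [hq]
      linear_combination
        (f * Complex.exp (((s * ((d - 2) * α) : ℝ) : ℂ) * Complex.I)) ^ 2 * hπ
    · rw [mul_pow, mul_pow, hf2, ← Complex.exp_nat_mul, ← Complex.exp_nat_mul]
      -- Two phases `(d - 2)α` cancel against `d - 2` phases `-2α`, so the product is preserved.
      have : Complex.exp ((2 : ℕ) * (((s * ((d - 2) * α) : ℝ) : ℂ) * Complex.I)) *
          Complex.exp ((us.length + 1 : ℕ) * (((-s * (2 * α) : ℝ) : ℂ) * Complex.I)) = 1 := by
        rw [← Complex.exp_add, ← Complex.exp_zero]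
        congr 1
        rw [hd]
        push_cast
        ring
      rw [Complex.ofReal_one]
      linear_combination (a' * b * y ^ (us.length + 1)) * this + b * e4
  · refine ⟨g, y, -1, rfl, hy, Or.inr rfl, ?_, ?_⟩
    · have hyf : y ^ 2 = f ^ 2 := by
        rw [linearIndependent_map_iff, not_not] at hi
        rcases eq_or_eq_neg_of_im_eq_zero hfn hy hi with h | h <;> rw [h]
        ring
      rw [hg2, hyf, hf2]
    · rw [hg2]
      push_cast
      linear_combination -b * e4

end Plane

/-! ### The multilinear form of the alternating tensor -/

section Alternating

open Finset

theorem sum_powersetCard_perm {d : ℕ} (V W : Fin d → ℝ) (j : ℕ) (η : Equiv.Perm (Fin d)) :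
    ∑ S ∈ powersetCard j univ, ∏ i, (if η i ∈ S then V i else W i) =
      ∑ S ∈ powersetCard j univ, ∏ i, (if i ∈ S then V i else W i) := by
  refine Finset.sum_equiv (Equiv.finsetCongr η.symm) (fun S => ?_) (fun S _ => ?_)
  · simp [mem_powersetCard]
  · refine Finset.prod_congr rfl fun i _ => ?_
    have : i ∈ Equiv.finsetCongr η.symm S ↔ η i ∈ S := by
      rw [Equiv.finsetCongr_apply, Finset.mem_map_equiv, Equiv.symm_symm]
    simp only [this]

theorem sum_perm_eq_of_card_eq {d : ℕ} (V W : Fin d → ℝ) {S J : Finset (Fin d)} (h : #S = #J) :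
    ∑ η : Equiv.Perm (Fin d), ∏ i, (if η i ∈ S then V i else W i) =
      ∑ η : Equiv.Perm (Fin d), ∏ i, (if η i ∈ J then V i else W i) := by
  let e : {x // x ∈ S} ≃ {x // x ∈ J} := Finset.equivOfCardEq h
  have he : ∀ x, e.extendSubtype x ∈ J ↔ x ∈ S := fun x =>
    ⟨fun hx => by_contra fun hn => e.extendSubtype_not_mem x hn hx, e.extendSubtype_mem x⟩
  rw [← Equiv.sum_comp (Equiv.mulLeft e.extendSubtype)
    (fun η : Equiv.Perm (Fin d) => ∏ i, (if η i ∈ J then V i else W i))]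
  simp [he]

/-- The average over all permutations is the average over all subsets. -/
theorem choose_mul_average {d : ℕ} (V W : Fin d → ℝ) {j : ℕ} (hj : j ≤ d) :
    (d.choose j : ℝ) * (1 / (d.factorial : ℝ) *
      ∑ η : Equiv.Perm (Fin d), ∏ i, (if (η i : ℕ) < j then V i else W i)) =
      ∑ S ∈ powersetCard j univ, (∏ i ∈ S, V i) * ∏ i ∈ univ \ S, W i := by
  set J : Finset (Fin d) := univ.filter fun i => (i : ℕ) < j with hJ
  have hJc : #J = j := by
    rw [hJ, Fin.card_filter_val_lt]
    exact min_eq_right hj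
  -- Double counting over pairs `(S, η)`: for fixed `S` the sum depends only on the size of `S`,
  -- while for fixed `η` the permutation merely relabels the subsets.
  have h1 : ∑ S ∈ powersetCard j univ, ∑ η : Equiv.Perm (Fin d),
      ∏ i, (if η i ∈ S then V i else W i) = d.choose j •
      ∑ η : Equiv.Perm (Fin d), ∏ i, (if η i ∈ J then V i else W i) := by
    rw [Finset.sum_congr rfl fun S hS => sum_perm_eq_of_card_eq V W
      ((mem_powersetCard.mp hS).2.trans hJc.symm), Finset.sum_const, card_powersetCard,
      card_univ, Fintype.card_fin]
  rw [Finset.sum_comm, Finset.sum_congr rfl fun η _ => sum_powersetCard_perm V W j η,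
    Finset.sum_const, card_univ, Fintype.card_perm, Fintype.card_fin] at h1
  have h2 : ∀ S : Finset (Fin d), ∏ i, (if i ∈ S then V i else W i) =
      (∏ i ∈ S, V i) * ∏ i ∈ univ \ S, W i := by
    intro S
    rw [Finset.prod_ite]
    congr 2
    · ext; simp
    · ext; simp
  simp only [h2, nsmul_eq_mul, hJ, mem_filter, mem_univ, true_and] at h1
  have h3 : (d.factorial : ℝ) ≠ 0 := by positivity
  field_simp
  exact h1.symm

theorem L_symElem_mixed {d n : ℕ} (j : ℕ) (v w : Vec n) (y : Fin d → Vec n) :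
    L (symElem (mixed d j v w)) y = 1 / (d.factorial : ℝ) * ∑ η : Equiv.Perm (Fin d),
      ∏ i, (if (η i : ℕ) < j then inner ℝ v (y i) else inner ℝ w (y i)) := by
  rw [L_apply, symElem, map_smul, LinearMap.smul_apply, map_sum, LinearMap.sum_apply, smul_eq_mul]
  congr 1
  refine Finset.sum_congr rfl fun η _ => ?_
  rw [hsInner_elem]
  refine Finset.prod_congr rfl fun i _ => ?_
  rw [mixed]
  split_ifs <;> rfl

theorem re_I_pow_two_mul (τ : ℝ) (hτ : τ = 1 ∨ τ = -1) (l : ℕ) :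
    ((τ * Complex.I : ℂ) ^ (2 * l)) = ((-1) ^ l : ℝ) := by
  rw [pow_mul, mul_pow, Complex.I_sq]
  rcases hτ with rfl | rfl <;> simp

/-- Subsets of size `j` contribute with the factor `(τ i)^j`, which is `(-1)^l` for `j = 2l` and
purely imaginary for odd `j`. The result is therefore the same for both signs `τ`. -/
theorem L_alternatingTensor {d n : ℕ} (v w : Vec n) (y : Fin d → Vec n) {τ : ℝ}
    (hτ : τ = 1 ∨ τ = -1) :
    L (alternatingTensor d v w) y =
      (∏ i, ((τ * Complex.I) * (inner ℝ v (y i) : ℝ) + (inner ℝ w (y i) : ℝ) : ℂ)).re := by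
  have h1 : L (alternatingTensor d v w) y = ∑ l ∈ range (d / 2 + 1),
      (-1) ^ l * ∑ S ∈ powersetCard (2 * l) univ,
        (∏ i ∈ S, inner ℝ v (y i)) * ∏ i ∈ univ \ S, inner ℝ w (y i) := by
    rw [L_apply, alternatingTensor, map_sum, LinearMap.sum_apply]
    refine Finset.sum_congr rfl fun l hl => ?_
    rw [map_smul, LinearMap.smul_apply, ← L_apply, L_symElem_mixed, smul_eq_mul,
      ← choose_mul_average _ _ (by have := mem_range.mp hl; omega)]
    ring
  rw [h1, Finset.prod_add, Finset.sum_powerset, Complex.re_sum, card_univ, Fintype.card_fin]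
  have h2 : ∀ j, (∑ S ∈ powersetCard j univ,
      (∏ i ∈ S, ((τ * Complex.I) * (inner ℝ v (y i) : ℝ) : ℂ)) *
        ∏ i ∈ univ \ S, ((inner ℝ w (y i) : ℝ) : ℂ)) = (τ * Complex.I) ^ j *
      ((∑ S ∈ powersetCard j univ,
        (∏ i ∈ S, inner ℝ v (y i)) * ∏ i ∈ univ \ S, inner ℝ w (y i) : ℝ) : ℂ) := by
    intro j
    push_cast
    rw [Finset.mul_sum]
    refine Finset.sum_congr rfl fun S hS => ?_
    rw [Finset.prod_mul_distrib, Finset.prod_const, (mem_powersetCard.mp hS).2]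
    ring
  refine Finset.sum_of_injOn (fun l => 2 * l) (fun a _ b _ h => by simpa using h) ?_ ?_ ?_
  · intro l hl
    have := mem_range.mp hl
    simp only [coe_range, Set.mem_Iio]
    omega
  · intro j hj hj'
    rw [h2]
    rcases Nat.even_or_odd' j with ⟨l, rfl | rfl⟩
    · refine absurd ⟨l, ?_, rfl⟩ hj'
      have := mem_range.mp hj
      simp only [coe_range, Set.mem_Iio]
      omega
    · rw [pow_succ, re_I_pow_two_mul τ hτ, Complex.re_mul_ofReal, Complex.re_ofReal_mul]
      simp
  · intro l _
    rw [h2, re_I_pow_two_mul τ hτ, ← Complex.ofReal_mul, Complex.ofReal_re]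

end Alternating

/-! ### Existence of a reordering; the plane as a copy of `ℂ` -/

section Reorder

variable {n : ℕ}

theorem firstTwoIndep_ofFn {d : ℕ} (X : Fin (d + 2) → Vec n) :
    FirstTwoIndep (List.ofFn X) ↔ LinearIndependent ℝ ![X 0, X 1] := by
  rw [List.ofFn_succ, List.ofFn_succ]
  rfl

theorem linearIndependent_unit {a b : Vec n} (h : LinearIndependent ℝ ![a, b]) :
    LinearIndependent ℝ ![unit a, unit b] := by
  have ha : ‖a‖⁻¹ ≠ 0 := inv_ne_zero (norm_ne_zero_iff.mpr (h.ne_zero 0))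
  have hb : ‖b‖⁻¹ ≠ 0 := inv_ne_zero (norm_ne_zero_iff.mpr (h.ne_zero 1))
  rw [LinearIndependent.pair_iff] at h ⊢
  intro s t hst
  rw [unit, unit, smul_smul, smul_smul] at hst
  obtain ⟨h1, h2⟩ := h _ _ hst
  exact ⟨(mul_eq_zero.mp h1).resolve_right ha, (mul_eq_zero.mp h2).resolve_right hb⟩

theorem ne_zero_of_not_isSymm {d : ℕ} {x : Fin d → Vec n} (h : ¬ IsSymm (elem x)) (i : Fin d) :
    x i ≠ 0 := by
  intro h0
  apply h
  have : elem x = 0 := (PiTensorProduct.tprod ℝ).map_coord_zero i h0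
  intro η
  rw [this, map_zero]

/-- If all factors were multiples of one vector, `elem x` would be a multiple of a pure power, with
a coefficient unchanged by permutations. -/
theorem exists_linearIndependent {d : ℕ} {x : Fin d → Vec n} (h : ¬ IsSymm (elem x)) :
    ∃ i j, LinearIndependent ℝ ![x i, x j] := by
  by_contra! hn
  apply h
  intro η
  rw [permute_elem]
  rcases isEmpty_or_nonempty (Fin d) with hd | ⟨⟨i₀⟩⟩
  · congr 1
    exact Subsingleton.elim _ _
  have hc : ∀ j, ∃ c : ℝ, c • x i₀ = x j := by
    intro j
    have := hn i₀ j
    rw [LinearIndependent.pair_iff' (ne_zero_of_not_isSymm h i₀)] at this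
    push Not at this
    exact this
  choose c hc using hc
  have key : ∀ σ : Equiv.Perm (Fin d),
      elem (fun i => x (σ i)) = (∏ i, c (σ i)) • elem (fun _ => x i₀) := by
    intro σ
    rw [elem, elem, ← MultilinearMap.map_smul_univ]
    simp only [hc]
  have h1 := key 1
  simp only [Equiv.Perm.one_apply] at h1
  rw [key η.symm, Equiv.prod_comp]
  exact h1.symm

theorem exists_firstTwoIndep {d : ℕ} {x : Fin d → Vec n} (h : ¬ IsSymm (elem x)) :
    ∃ η : Equiv.Perm (Fin d), FirstTwoIndep (reordered x η) := by
  obtain ⟨i, j, hij⟩ := exists_linearIndependent h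
  have hne : i ≠ j := by
    rintro rfl
    exact absurd (hij.injective (a₁ := 0) (a₂ := 1) rfl) (by simp)
  rcases d with _ | _ | d
  · exact i.elim0
  · exact absurd (Subsingleton.elim (α := Fin 1) i j) hne
  set σ : Equiv.Perm (Fin (d + 2)) := Equiv.swap 0 i
  refine ⟨(Equiv.swap 1 (σ j)).trans σ, ?_⟩
  rw [reordered, firstTwoIndep_ofFn]
  have h0 : σ (Equiv.swap 1 (σ j) 0) = i := by
    have : (0 : Fin (d + 2)) ≠ σ j := by
      intro h0
      apply hne
      rw [← σ.injective.eq_iff, ← h0]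
      simp [σ]
    rw [Equiv.swap_apply_of_ne_of_ne (by simp) this]
    simp [σ]
  have h1 : σ (Equiv.swap 1 (σ j) 1) = j := by simp [σ]
  rw [Equiv.trans_apply, Equiv.trans_apply, h0, h1]
  exact linearIndependent_unit hij

theorem exists_isometry_range_eq_span {a b : Vec n} (h : LinearIndependent ℝ ![a, b]) :
    ∃ ψ : ℂ →ₗᵢ[ℝ] Vec n, LinearMap.range ψ.toLinearMap = Submodule.span ℝ {a, b} := by
  set P := Submodule.span ℝ ({a, b} : Set (Vec n))
  have hP : Module.finrank ℝ P = 2 := by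
    have := finrank_span_eq_card h
    rwa [Matrix.range_cons_cons_empty, Fintype.card_fin] at this
  let e : ℂ ≃ₗᵢ[ℝ] P := Complex.isometryOfOrthonormal
    ((stdOrthonormalBasis ℝ P).reindex (finCongr hP))
  refine ⟨P.subtypeₗᵢ.comp e.toLinearIsometry, ?_⟩
  ext u
  constructor
  · rintro ⟨c, rfl⟩
    exact (e c).2
  · intro hu
    exact ⟨e.symm ⟨u, hu⟩, by simp⟩

end Reorder

/-! ### Assembling the recovery of the form -/

section Main

open ComplexConjugate

theorem isSymmBounded_unit {d n : ℕ} {z : Tens (d + 2) n} {x : Fin (d + 2) → Vec n}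
    (hz : IsSymm z) (hbest : IsBestRankApprox 1 z (elem x)) (hx : ∀ i, x i ≠ 0) :
    IsSymmBounded (∏ i, ‖x i‖) (L z) ∧
      ∀ η : Equiv.Perm (Fin (d + 2)), L z (fun i => unit (x (η i))) = ∏ i, ‖x i‖ := by
  have hpos : 0 < ∏ i, ‖x i‖ := Finset.prod_pos fun i _ => norm_pos_iff.mpr (hx i)
  refine ⟨⟨hz.L_comp, hbest.abs_L_le 0 hpos⟩, fun η => ?_⟩
  rw [hz.L_comp η (fun i => unit (x i))]
  simp only [unit]
  rw [MultilinearMap.map_smul_univ, hbest.L_self 0 hpos, Finset.prod_inv_distrib, smul_eq_mul]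
  field_simp

/-- In complex coordinates of the plane spanned by a best rank-one approximation, the form of
the tensor is the real part of a multiple of the product of the coordinates. -/
theorem exists_plane {d n : ℕ} {z : Tens (d + 2) n} {x : Fin (d + 2) → Vec n} (hz : IsSymm z)
    (hbest : IsBestRankApprox 1 z (elem x)) (hx : ∀ i, x i ≠ 0)
    {η : Equiv.Perm (Fin (d + 2))} (hη : FirstTwoIndep (reordered x η)) :
    ∃ (ψ : ℂ →ₗᵢ[ℝ] Vec n) (t : Fin (d + 2) → ℂ), (∀ i, ‖t i‖ = 1) ∧
      (∀ i, unit (x (η i)) = ψ (t i)) ∧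
      LinearMap.range ψ.toLinearMap = Submodule.span ℝ (Set.range x) ∧
      ∀ c : Fin (d + 2) → ℂ,
        L z (fun i => ψ (c i)) = (∏ i, ‖x i‖) * (∏ i, conj (t i) * c i).re := by
  have hpos : 0 < ∏ i, ‖x i‖ := Finset.prod_pos fun i _ => norm_pos_iff.mpr (hx i)
  obtain ⟨hL, hLη⟩ := isSymmBounded_unit hz hbest hx
  rw [reordered, firstTwoIndep_ofFn] at hη
  set X : Fin (d + 2) → Vec n := fun i => unit (x (η i)) with hX
  have hXn : ∀ i, ‖X i‖ = 1 := fun i => by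
    simp only [hX, unit]
    rw [norm_smul, norm_inv, norm_norm, inv_mul_cancel₀ (norm_ne_zero_iff.mpr (hx _))]
  obtain ⟨ψ, hψ⟩ := exists_isometry_range_eq_span hη
  have hη' := hη
  rw [LinearIndependent.pair_iff] at hη'
  have hspan := hL.mem_span hpos hXn (hLη η)
    (fun h => by simpa using (hη' 1 1 (by simpa [hX] using h)).1)
    (fun h => by simpa using (hη' 1 (-1) (by simpa [hX, sub_eq_add_neg] using h)).1)
  have ht : ∀ i, ∃ t, ψ t = X i := fun i => by
    have := hspan i
    rwa [← hψ] at this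
  choose t ht using ht
  have htn : ∀ i, ‖t i‖ = 1 := fun i => by rw [← ψ.norm_map, ht, hXn]
  refine ⟨ψ, t, htn, fun i => (ht i).symm, ?_, ?_⟩
  · apply le_antisymm
    · have hmem : ∀ i, X i ∈ Submodule.span ℝ (Set.range x) := fun i =>
        Submodule.smul_mem _ _ (Submodule.subset_span ⟨η i, rfl⟩)
      rw [hψ, Submodule.span_le]
      rintro _ (rfl | rfl)
      · exact hmem 0
      · exact hmem 1
    · rw [Submodule.span_le]
      rintro _ ⟨i, rfl⟩
      have : x i = ‖x i‖ • X (η.symm i) := by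
        simp only [hX, unit, Equiv.apply_symm_apply]
        rw [smul_smul, mul_inv_cancel₀ (norm_ne_zero_iff.mpr (hx i)), one_smul]
      rw [this, SetLike.mem_coe, hψ]
      exact Submodule.smul_mem _ _ (hspan _)
  · have hN : IsSymmBounded (∏ i, ‖x i‖) ((L z).compLinearMap fun _ => ψ.toLinearMap) :=
      ⟨fun σ y => hL.symm σ (fun i => ψ (y i)), fun y => by
        simpa using hL.bound (fun i => ψ (y i))⟩
    have hNt : (L z).compLinearMap (fun _ => ψ.toLinearMap) t = ∏ i, ‖x i‖ := by
      rw [← hLη η]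
      exact congrArg (L z) (funext ht)
    refine hN.eq_re_prod hpos htn ?_ hNt
    rw [← linearIndependent_map_iff ψ, ht, ht]
    exact hη

theorem prod_mixed {d : ℕ} (p q : ℂ) :
    ∏ i : Fin (d + 2), (if (i : ℕ) < 2 then p else q) = p ^ 2 * q ^ d := by
  rw [Fin.prod_univ_succ, Fin.prod_univ_succ]
  simp [sq, mul_assoc]

theorem recover_spec {d n : ℕ} {z : Tens (d + 2) n} {x : Fin (d + 2) → Vec n} (hz : IsSymm z)
    (hbest : IsBestRankApprox 1 z (elem x)) (hx : ∀ i, x i ≠ 0)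
    {η : Equiv.Perm (Fin (d + 2))} (hη : FirstTwoIndep (reordered x η)) :
    (recover x η).v ∈ Submodule.span ℝ (Set.range x) ∧
    (recover x η).w ∈ Submodule.span ℝ (Set.range x) ∧
    ‖(recover x η).v‖ = 1 ∧ ‖(recover x η).w‖ = 1 ∧
    inner ℝ (recover x η).v (recover x η).w = 0 ∧
    ((recover x η).ε = 1 ∨ (recover x η).ε = -1) ∧
    L z (mixed (d + 2) 2 (recover x η).v (recover x η).w) = (recover x η).ε * ∏ i, ‖x i‖ ∧
    (∀ y : Fin (d + 2) → Vec n, (∀ i, y i ∈ Submodule.span ℝ (Set.range x)) →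
      L z y = L (recoveredTensor x η) y) ∧
    (n = 2 → Submodule.span ℝ (Set.range x) = ⊤) := by
  obtain ⟨ψ, t, htn, ht, hψ, hL⟩ := exists_plane hz hbest hx hη
  have hlist : reordered x η = (List.ofFn t).map ψ := by
    rw [reordered, List.map_ofFn]
    exact congrArg List.ofFn (funext ht)
  obtain ⟨p, q, ε, τ, hproc, hq, hε, hτ, hp, hpq⟩ := procedure_map ψ (List.ofFn t)
    (fun s hs => by
      obtain ⟨i, rfl⟩ := (List.mem_ofFn' _ _).mp hs
      exact htn i) (hlist ▸ hη)
  have hτ2 : τ * τ = 1 := by rcases hτ with rfl | rfl <;> norm_num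
  have hε2 : ε * ε = 1 := by rcases hε with rfl | rfl <;> norm_num
  rw [List.length_ofFn, Nat.add_sub_cancel, List.prod_ofFn] at hpq
  have hrec : recover x η = ⟨ψ p, ψ q, ε⟩ := by rw [recover, hlist, hproc]
  have hpn : ‖p‖ = 1 := by
    rw [hp]
    rcases hτ with rfl | rfl <;> simp [hq]
  have hmem : ∀ c, ψ c ∈ Submodule.span ℝ (Set.range x) := fun c => by
    rw [← hψ]
    exact ⟨c, rfl⟩
  rw [recoveredTensor, hrec]
  refine ⟨hmem p, hmem q, by rw [ψ.norm_map, hpn], by rw [ψ.norm_map, hq], ?_, hε, ?_, ?_, ?_⟩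
  · rw [inner_map_eq_re, hp]
    have : conj (τ * Complex.I * q) * q = -(τ * Complex.I) := by
      rw [map_mul, map_mul, Complex.conj_ofReal, Complex.conj_I]
      linear_combination -(τ * Complex.I) * conj_mul_self_of_norm hq
    rw [this]
    simp
  · have h1 : mixed (d + 2) 2 (ψ p) (ψ q) =
        fun i : Fin (d + 2) => ψ (if (i : ℕ) < 2 then p else q) := by
      ext1 i
      rw [mixed]
      split_ifs <;> rfl
    have h2 : (∏ i, conj (t i)) * ∏ i, t i = 1 := by
      rw [← Finset.prod_mul_distrib]
      exact Finset.prod_eq_one fun i _ => conj_mul_self_of_norm (htn i)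
    have h3 : (∏ i, conj (t i)) * (ε * ∏ i, t i) = (ε : ℂ) := by
      linear_combination (ε : ℂ) * h2
    rw [h1, hL, Finset.prod_mul_distrib, prod_mixed, hpq, h3, Complex.ofReal_re]
    ring
  · intro y hy
    have hc : ∀ i, ∃ c, ψ c = y i := fun i => by
      have := hy i
      rwa [← hψ] at this
    choose c hc using hc
    obtain rfl : (fun i => ψ (c i)) = y := funext hc
    -- Substitute `p² = -q²` in the preserved product.
    have h1 : ∏ i, t i = -ε * q ^ (d + 2) := by
      have hε2' : (ε : ℂ) * ε = 1 := by exact_mod_cast hε2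
      have hτ2' : (τ : ℂ) * τ = 1 := by exact_mod_cast hτ2
      have hpp : p ^ 2 = -q ^ 2 := by
        rw [hp]
        linear_combination (τ * τ * q ^ 2) * Complex.I_sq - q ^ 2 * hτ2'
      rw [hpp] at hpq
      linear_combination -(∏ i, t i) * hε2' - ε * hpq
    -- As `p = τ i q`, the inner product with `ψ p` is `τ` times the imaginary part of `conj q * c
    -- i`.
    have h2 : ∀ i, (τ * Complex.I) * (inner ℝ (ψ p) (ψ (c i)) : ℝ) +
        (inner ℝ (ψ q) (ψ (c i)) : ℝ) = conj q * c i := by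
      intro i
      have : conj p * c i = -(τ * Complex.I) * (conj q * c i) := by
        rw [hp, map_mul, map_mul, Complex.conj_ofReal, Complex.conj_I]
        ring
      rw [inner_map_eq_re, inner_map_eq_re, this]
      generalize conj q * c i = u
      apply Complex.ext
      · simp
      · simp
        linear_combination u.im * hτ2
    rw [hL, L_apply, map_smul, LinearMap.smul_apply, ← L_apply, L_alternatingTensor _ _ _ hτ,
      Finset.prod_congr rfl fun i _ => h2 i, Finset.prod_mul_distrib, Finset.prod_mul_distrib,
      Finset.prod_const, ← map_prod, h1, Finset.card_univ, Fintype.card_fin, smul_eq_mul]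
    have h3 : conj (-ε * q ^ (d + 2)) * ∏ i, c i =
        ((-ε : ℝ) : ℂ) * (conj q ^ (d + 2) * ∏ i, c i) := by
      rw [map_mul, map_neg, Complex.conj_ofReal, map_pow]
      push_cast
      ring
    rw [h3, Complex.re_ofReal_mul]
    ring
  · rintro rfl
    rw [← hψ]
    apply LinearMap.range_eq_top.mpr
    exact (LinearMap.injective_iff_surjective_of_finrank_eq_finrank (by simp)).mp ψ.injective

end Main

end SymTensor

end

theorem mainTheorem5 {d n : ℕ} (z : SymTensor.Tens d n) (x : Fin d → SymTensor.Vec n)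
    (hz : SymTensor.IsSymm z)
    (hbest : SymTensor.IsBestRankApprox 1 z (SymTensor.elem x))
    (hns : ¬ SymTensor.IsSymm (SymTensor.elem x)) :
    (∃ η : Equiv.Perm (Fin d), SymTensor.FirstTwoIndep (SymTensor.reordered x η)) ∧
    (∀ η : Equiv.Perm (Fin d), SymTensor.FirstTwoIndep (SymTensor.reordered x η) →
      (SymTensor.recover x η).v ∈ Submodule.span ℝ (Set.range x) ∧
      (SymTensor.recover x η).w ∈ Submodule.span ℝ (Set.range x) ∧
      ‖(SymTensor.recover x η).v‖ = 1 ∧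
      ‖(SymTensor.recover x η).w‖ = 1 ∧
      inner ℝ (SymTensor.recover x η).v (SymTensor.recover x η).w = 0 ∧
      ((SymTensor.recover x η).ε = 1 ∨ (SymTensor.recover x η).ε = -1) ∧
      SymTensor.L z (SymTensor.mixed d 2 (SymTensor.recover x η).v (SymTensor.recover x η).w) =
        (SymTensor.recover x η).ε * ∏ i, ‖x i‖ ∧
      SymTensor.IsBestRankApprox 1 z (((SymTensor.recover x η).ε * ∏ i, ‖x i‖) •
        SymTensor.elem
          (SymTensor.mixed d 2 (SymTensor.recover x η).v (SymTensor.recover x η).w)) ∧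
      (∀ y : Fin d → SymTensor.Vec n, (∀ i, y i ∈ Submodule.span ℝ (Set.range x)) →
        SymTensor.L z y = SymTensor.L (SymTensor.recoveredTensor x η) y) ∧
      (n = 2 → z = SymTensor.recoveredTensor x η)) ∧
    (∀ z' : SymTensor.Tens d n, SymTensor.IsSymm z' →
      SymTensor.IsBestRankApprox 1 z' (SymTensor.elem x) →
      (∀ y : Fin d → SymTensor.Vec n, (∀ i, y i ∈ Submodule.span ℝ (Set.range x)) →
        SymTensor.L z y = SymTensor.L z' y) ∧
      (n = 2 → z = z')) := by
  have hx := SymTensor.ne_zero_of_not_isSymm hns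
  have hex := SymTensor.exists_firstTwoIndep hns
  have hpos : 0 < ∏ i, ‖x i‖ := Finset.prod_pos fun i _ => norm_pos_iff.mpr (hx i)
  obtain ⟨η₀, hη₀⟩ := hex
  -- For `d < 2` the list has no first two entries, so `hη₀` is false.
  rcases d with _ | _ | d
  · simp [SymTensor.reordered, SymTensor.FirstTwoIndep] at hη₀
  · simp [SymTensor.reordered, SymTensor.FirstTwoIndep] at hη₀
  refine ⟨⟨η₀, hη₀⟩, fun η hη => ?_, fun z' hz' hbest' => ?_⟩
  · obtain ⟨h1, h2, h3, h4, h5, h6, h7, h8, h9⟩ := SymTensor.recover_spec hz hbest hx hη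
    refine ⟨h1, h2, h3, h4, h5, h6, h7, hbest.of_L_eq 0 hpos h6 (fun i => ?_) h7, h8, fun hn => ?_⟩
    · rw [SymTensor.mixed]
      split_ifs
      exacts [h3, h4]
    · exact SymTensor.L_injective fun y => h8 y fun i => by rw [h9 hn]; trivial
  · obtain ⟨-, -, -, -, -, -, -, h8, h9⟩ := SymTensor.recover_spec hz hbest hx hη₀
    obtain ⟨-, -, -, -, -, -, -, h8', -⟩ := SymTensor.recover_spec hz' hbest' hx hη₀
    -- `recoveredTensor x η₀` does not involve the tensor being approximated, so both forms agree
    -- with the same one.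
    have h := fun y hy => (h8 y hy).trans (h8' y hy).symm
    exact ⟨h, fun hn => SymTensor.L_injective fun y => h y fun i => by rw [h9 hn]; trivial⟩
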